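/- **Conventions.** Let $\mathbb D$ be the closed Euclidean unit ball of the space at hand ($\mathbb R^n$ or $\mathbb R^{2n}$), and let $A_*=A\setminus\{0\}$. We write $X\sim L^n(\mu,\Sigma,\mathcal X)$ if $X=(X(t))_{t\ge0}$ is an $n$-dimensional Lévy process (a.s. càdlàg paths, $X(0)=0$ a.s., independent stationary increments) with $\mathbb E\,e^{i\langle\theta,X(t)\rangle}=e^{t\Psi(\theta)}$ and $$\Psi(\theta)=i\langle\mu,\theta\rangle-\tfrac12\theta\Sigma\theta'+\int_{\mathbb R^n_*}\bigl(e^{i\langle\theta,x\rangle}-1-i\langle\theta,x\rangle\mathbf 1_{\mathbb D}(x)\bigr)\,\mathcal X(dx),$$ where $\mu\in\mathbb R^n$, $\Sigma$ is a covariance matrix and $\int_{\mathbb R^n_*}(\|x\|^2\wedge1)\,\mathcal X(dx)<\infty$. We write $T\sim S^n(d,\mathcal T)$ if $T$ is a Lévy process with nondecreasing components, Lévy measure $\mathcal T$ (so that $T$ has Gaussian covariance $0$ and $\int_{\mathbb D_*}\|t\|\,\mathcal T(dt)<\infty$) and drift $d=\gamma-\int_{\mathbb D_*}t\,\mathcal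 T(dt)\in[0,\infty)^n$, where $\gamma$ is the location vector in its triplet $(\gamma,0,\mathcal T)$. For $t=(t_1,\dots,t_n)\in[0,\infty)^n$ put $X(t)=(X_1(t_1),\dots,X_n(t_n))$. Order the coordinates as $t_{(1)}\le\dots\le t_{(n)}$, put $t_{(0)}=0$, $\Delta t_{(k)}=t_{(k)}-t_{(k-1)}$ and $J_k=\{(k),\dots,(n)\}$, and let $\pi_J$ be the coordinate projection $\pi_J(x)=\sum_{j\in J}x_je_j$ and $\mathcal X_J$ the restriction to $\mathbb R^n_*$ of the image of $\mathcal X$ under $\pi_J$. Define $$t\diamond\mu=(t_k\mu_k)_k,\qquad (t\diamond\Sigma)_{kl}=\Sigma_{kl}(t_k\wedge t_l),\qquad t\diamond\mathcal X=\sum_{k=1}^n\Delta t_{(k)}\,\mathcal X_{J_k},$$ $$c(t,\mathcal X)=\sum_{k=2}^n\Delta t_{(k)}\int_{\mathbb D^C}\pi_{J_k}(x)\,\mathbf 1_{\mathbb D}(\pi_{J_k}(x))\,\mathcal X(dx).$$ Let $X\sim L^n(\mu,\Sigma,\mathcal X)$ and $T\sim S^n(d,\mathcal T)$. We say that $Z\overset{d}{=}(T,X\odot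 T)$ *in the weak sense* if $Z$ (possibly defined on another probability space) is a $2n$-dimensional Lévy process $Z\sim L^{2n}((m_1,m_2),\Theta,\mathcal Z)$ with $$m_1=d+\int_{[0,\infty)^n_*}t\,\mathbb P\bigl((t,X(t))\in\mathbb D\bigr)\,\mathcal T(dt),$$ $$m_2=c(d,\mathcal X)+d\diamond\mu+\int_{[0,\infty)^n_*}\mathbb E\bigl[X(t)\mathbf 1_{\mathbb D}(t,X(t))\bigr]\,\mathcal T(dt),$$ $$\Theta=\begin{pmatrix}0&0\\0&d\diamond\Sigma\end{pmatrix},\qquad \mathcal Z(dt,dx)=\bigl(\delta_0\otimes(d\diamond\mathcal X)\bigr)(dt,dx)+\mathbf 1_{[0,\infty)^n_*\times\mathbb R^n}(t,x)\,\mathbb P(X(t)\in dx)\,\mathcal T(dt).$$ **Proposition.** Let $X\sim L^n(\mu,\Sigma,\mathcal X)$ and $T\sim S^n(d,\mathcal T)$ be independent processes on a common probability space, and let $Z\overset{d}{=}(T,X\odot T)$ in the weak sense. If $T$ has monotone components, that is, almost surely $T_1(t)\le T_2(t)\le\dots\le T_n(t)$ for all $t\ge0$, then for every fixed $t\ge0$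 $$Z(t)\overset{d}{=}\bigl(T(t),X(T(t))\bigr),$$ where $X(T(t))=(X_1(T_1(t)),\dots,X_n(T_n(t)))$. -/

import Mathlib

open MeasureTheory ProbabilityTheory Filter Topology
open scoped NNReal ENNReal

noncomputable section

namespace WeakSubordination

section Levy

variable {ι : Type*} [Fintype ι] {Ω : Type*} [MeasurableSpace Ω]

/-- A path indexed by `[0, ∞)` is càdlàg: right-continuous with left limits. -/
def IsCadlag (f : ℝ≥0 → EuclideanSpace ℝ ι) : Prop :=
  (∀ t, ContinuousWithinAt f (Set.Ici t) t) ∧ ∀ t, ∃ l, Tendsto f (𝓝[<] t) (𝓝 l)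

/-- Lévy processes: started at zero, with independent and stationary increments, stochastically
continuous, with almost surely càdlàg paths. -/
structure IsLevyProcess (X : ℝ≥0 → Ω → EuclideanSpace ℝ ι) (P : Measure Ω) : Prop where
  measurable : ∀ t, Measurable (X t)
  zero : ∀ᵐ ω ∂P, X 0 ω = 0
  indep : HasIndepIncrements X P
  stationary : ∀ s t, IdentDistrib (fun ω => X (s + t) ω - X s ω) (X t) P P
  stochCont : ∀ t, TendstoInMeasure P X (𝓝 t) (X t)
  cadlag : ∀ᵐ ω ∂P, IsCadlag (fun t => X t ω)

/-- Lévy measures. A Borel measure on the punctured space is encoded as a Borel measure on the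
whole space without mass at the origin. -/
structure IsLevyMeasure (ν : Measure (EuclideanSpace ℝ ι)) : Prop where
  zero : ν {0} = 0
  lintegral_lt_top : ∫⁻ x, ENNReal.ofReal (min (‖x‖ ^ 2) 1) ∂ν < ∞

/-- The Lévy exponent
`Ψ(θ) = i⟨γ,θ⟩ - ½ θ C θ' + ∫ (exp(i⟨θ,x⟩) - 1 - i⟨θ,x⟩ 1_𝔻(x)) ν(dx)`,
where `𝔻` is the closed Euclidean unit ball. -/
def levyExponent (γ : EuclideanSpace ℝ ι) (C : Matrix ι ι ℝ)
    (ν : Measure (EuclideanSpace ℝ ι)) (θ : EuclideanSpace ℝ ι) : ℂ :=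
  Complex.I * ((inner ℝ γ θ : ℝ) : ℂ)
    - (1 / 2) * ((∑ k, ∑ l, θ k * C k l * θ l : ℝ) : ℂ)
    + ∫ x, (Complex.exp (Complex.I * ((inner ℝ θ x : ℝ) : ℂ)) - 1
        - Complex.I * (((Metric.closedBall (0 : EuclideanSpace ℝ ι) 1).indicator
            (fun y => inner ℝ θ y) x : ℝ) : ℂ)) ∂ν

/-- `X ∼ L(γ, C, ν)`: `X` is a Lévy process with canonical triplet `(γ, C, ν)`. -/
structure HasTriplet (X : ℝ≥0 → Ω → EuclideanSpace ℝ ι) (P : Measure Ω)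
    (γ : EuclideanSpace ℝ ι) (C : Matrix ι ι ℝ) (ν : Measure (EuclideanSpace ℝ ι)) : Prop where
  isLevyProcess : IsLevyProcess X P
  posSemidef : C.PosSemidef
  isLevyMeasure : IsLevyMeasure ν
  charFun_eq : ∀ (t : ℝ≥0) (θ : EuclideanSpace ℝ ι),
    charFun (P.map (X t)) θ = Complex.exp ((t : ℂ) * levyExponent γ C ν θ)

/-- `X ∼ FV(d, ν)`: a Lévy process of finite variation with drift `d`, that is, with
Gaussian covariance zero, `∫_{𝔻∖{0}} ‖x‖ ν(dx) < ∞` and `d = γ - ∫_{𝔻∖{0}} x ν(dx)`. -/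
def IsFiniteVariation (X : ℝ≥0 → Ω → EuclideanSpace ℝ ι) (P : Measure Ω)
    (d : EuclideanSpace ℝ ι) (ν : Measure (EuclideanSpace ℝ ι)) : Prop :=
  ∃ γ : EuclideanSpace ℝ ι, HasTriplet X P γ 0 ν ∧
    IntegrableOn (fun x => x) (Metric.closedBall 0 1 \ {0}) ν ∧
    d = γ - ∫ x in Metric.closedBall 0 1 \ {0}, x ∂ν

/-- `T ∼ S(d, τ)`: a subordinator, i.e. a Lévy process with nondecreasing components, with
drift `d ∈ [0, ∞)^ι` and Lévy measure `τ`. -/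
structure IsSubordinator (T : ℝ≥0 → Ω → EuclideanSpace ℝ ι) (P : Measure Ω)
    (d : EuclideanSpace ℝ ι) (τ : Measure (EuclideanSpace ℝ ι)) : Prop where
  isFiniteVariation : IsFiniteVariation T P d τ
  drift_nonneg : ∀ k, 0 ≤ d k
  monotone : ∀ᵐ ω ∂P, ∀ k, Monotone (fun t => T t ω k)

/-- The vector `X(t) = (X₁(t₁), …, Xₙ(tₙ))` for a multivariate time point `t ∈ [0, ∞)^ι`
(negative coordinates, which are never relevant, are read as `0`). -/
def evalAt (X : ℝ≥0 → Ω → EuclideanSpace ℝ ι) (t : EuclideanSpace ℝ ι) (ω : Ω) :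
    EuclideanSpace ℝ ι :=
  WithLp.toLp 2 fun k => X (t k).toNNReal ω k

/-- The set `[0, ∞)^ι ∖ {0}`. -/
def puncturedOrthant (ι : Type*) : Set (EuclideanSpace ℝ ι) :=
  {t | (∀ k, 0 ≤ t k) ∧ t ≠ 0}

/-- The coordinate projection `π_J` onto the coordinates in `J`. -/
def proj (J : Set ι) (x : EuclideanSpace ℝ ι) : EuclideanSpace ℝ ι :=
  WithLp.toLp 2 (J.indicator x)

/-- The projected measure `ν_J` on the punctured space: the image of `ν` under `π_J` with any mass
at the origin removed. -/
def projMeasure (J : Set ι) (ν : Measure (EuclideanSpace ℝ ι)) : Measure (EuclideanSpace ℝ ι) :=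
  (ν.map (proj J)).restrict {0}ᶜ

/-- The pair `(x, y)` as a vector in the Euclidean space of doubled dimension. -/
def pair (x y : EuclideanSpace ℝ ι) : EuclideanSpace ℝ (ι ⊕ ι) :=
  WithLp.toLp 2 (Sum.elim x y)

end Levy

section MultivariateTime

variable {n : ℕ}

/-- With the ordering `t_(1) ≤ … ≤ t_(n)` of the coordinates (index shifted by one in `Fin n`),
the spacing `Δt_(k) = t_(k) - t_(k-1)`, where `t_(0) = 0`. -/
def spacing (t : EuclideanSpace ℝ (Fin n)) (k : Fin n) : ℝ :=
  t (Tuple.sort t k) -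
    if (k : ℕ) = 0 then 0 else t (Tuple.sort t ⟨(k : ℕ) - 1, by have := k.isLt; omega⟩)

/-- The set `{(k), …, (n)}` of coordinates. -/
def upperSet (t : EuclideanSpace ℝ (Fin n)) (k : Fin n) : Set (Fin n) :=
  {j | ∃ m, k ≤ m ∧ j = Tuple.sort t m}

/-- The outer product `t ⋄ μ = (t₁ μ₁, …, tₙ μₙ)`. -/
def diamondVec (t μ : EuclideanSpace ℝ (Fin n)) : EuclideanSpace ℝ (Fin n) :=
  WithLp.toLp 2 fun k => t k * μ k

/-- The outer product `(t ⋄ C)_{kl} = C_{kl} (t_k ∧ t_l)`. -/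
def diamondMat (t : EuclideanSpace ℝ (Fin n)) (C : Matrix (Fin n) (Fin n) ℝ) :
    Matrix (Fin n) (Fin n) ℝ :=
  Matrix.of fun k l => C k l * min (t k) (t l)

/-- The outer product `t ⋄ ν = ∑ₖ Δt_(k) ν_{{(k), …, (n)}}`. -/
def diamondMeasure (t : EuclideanSpace ℝ (Fin n)) (ν : Measure (EuclideanSpace ℝ (Fin n))) :
    Measure (EuclideanSpace ℝ (Fin n)) :=
  ∑ k, ENNReal.ofReal (spacing t k) • projMeasure (upperSet t k) ν

/-- The compensation term
`c(t, ν) = ∑_{k=2}^n Δt_(k) ∫_{𝔻ᶜ} π_{{(k), …, (n)}}(x) 1_𝔻(π_{{(k), …, (n)}}(x)) ν(dx)`. -/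
def compensation (t : EuclideanSpace ℝ (Fin n)) (ν : Measure (EuclideanSpace ℝ (Fin n))) :
    EuclideanSpace ℝ (Fin n) :=
  ∑ k ∈ Finset.univ.filter (fun k : Fin n => (k : ℕ) ≠ 0), spacing t k •
    ∫ x in (Metric.closedBall 0 1)ᶜ,
      (Metric.closedBall 0 1).indicator (fun y => y) (proj (upperSet t k) x) ∂ν

end MultivariateTime

section Weak

variable {n : ℕ} {Ω Ω' : Type*} [MeasurableSpace Ω] [MeasurableSpace Ω']

/-- `m₁ = d + ∫_{[0,∞)ⁿ∖{0}} t P((t, X(t)) ∈ 𝔻) τ(dt)`. -/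
def weakLoc₁ (X : ℝ≥0 → Ω → EuclideanSpace ℝ (Fin n)) (P : Measure Ω)
    (d : EuclideanSpace ℝ (Fin n)) (τ : Measure (EuclideanSpace ℝ (Fin n))) :
    EuclideanSpace ℝ (Fin n) :=
  d + ∫ t in puncturedOrthant (Fin n),
    P.real {ω | pair t (evalAt X t ω) ∈ Metric.closedBall 0 1} • t ∂τ

/-- `m₂ = c(d, ν) + d ⋄ μ + ∫_{[0,∞)ⁿ∖{0}} E[X(t) 1_𝔻(t, X(t))] τ(dt)`. -/
def weakLoc₂ (X : ℝ≥0 → Ω → EuclideanSpace ℝ (Fin n)) (P : Measure Ω)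
    (μ : EuclideanSpace ℝ (Fin n)) (ν : Measure (EuclideanSpace ℝ (Fin n)))
    (d : EuclideanSpace ℝ (Fin n)) (τ : Measure (EuclideanSpace ℝ (Fin n))) :
    EuclideanSpace ℝ (Fin n) :=
  compensation d ν + diamondVec d μ + ∫ t in puncturedOrthant (Fin n),
    (∫ ω in {ω | pair t (evalAt X t ω) ∈ Metric.closedBall 0 1}, evalAt X t ω ∂P) ∂τ

/-- `Θ = [[0, 0], [0, d ⋄ C]]`. -/
def weakCov (C : Matrix (Fin n) (Fin n) ℝ) (d : EuclideanSpace ℝ (Fin n)) :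
    Matrix (Fin n ⊕ Fin n) (Fin n ⊕ Fin n) ℝ :=
  Matrix.fromBlocks 0 0 0 (diamondMat d C)

/-- The Lévy measure `δ₀ ⊗ (d ⋄ ν) + 1_{([0,∞)ⁿ∖{0}) × ℝⁿ} P(X(t) ∈ dx) τ(dt)`. Here `δ₀ ⊗ ρ` is
written as the image of `ρ` under `x ↦ (0, x)`, and `P(X(t) ∈ dx) τ(dt)` as the mixture over
`τ(dt)` of the laws of `(t, X(t))`. -/
def weakLevyMeasure (X : ℝ≥0 → Ω → EuclideanSpace ℝ (Fin n)) (P : Measure Ω)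
    (ν : Measure (EuclideanSpace ℝ (Fin n)))
    (d : EuclideanSpace ℝ (Fin n)) (τ : Measure (EuclideanSpace ℝ (Fin n))) :
    Measure (EuclideanSpace ℝ (Fin n ⊕ Fin n)) :=
  (diamondMeasure d ν).map (fun x => pair 0 x)
    + (τ.restrict (puncturedOrthant (Fin n))).bind
        (fun t => P.map (fun ω => pair t (evalAt X t ω)))

/-- `Z ≗ (T, X ⊙ T)` in the weak sense, for `X ∼ L(μ, C, ν)` under `P` and `T ∼ S(d, τ)`:
`Z` is a `2n`-dimensional Lévy process, on a possibly different probability space, with the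
prescribed triplet. -/
def IsWeakSubordination (Z : ℝ≥0 → Ω' → EuclideanSpace ℝ (Fin n ⊕ Fin n)) (P' : Measure Ω')
    (X : ℝ≥0 → Ω → EuclideanSpace ℝ (Fin n)) (P : Measure Ω)
    (μ : EuclideanSpace ℝ (Fin n)) (C : Matrix (Fin n) (Fin n) ℝ)
    (ν : Measure (EuclideanSpace ℝ (Fin n)))
    (d : EuclideanSpace ℝ (Fin n)) (τ : Measure (EuclideanSpace ℝ (Fin n))) : Prop :=
  HasTriplet Z P' (pair (weakLoc₁ X P d τ) (weakLoc₂ X P μ ν d τ)) (weakCov C d)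
    (weakLevyMeasure X P ν d τ)

end Weak

end WeakSubordination

end

/-!
Both sides have characteristic function `exp(t κ(Λ))`, where `κ` is the cumulant of `T` and `Λ` is a
complex linear functional depending on `(θ₁, θ₂)`. Indeed, for `0 ≤ s₁ ≤ … ≤ sₙ` the vector `X(s)`
is a sum of projections of the independent increments of `X` over `[sⱼ₋₁, sⱼ]`, so that
`𝔼 exp(i⟨θ₁, s⟩ + i⟨θ₂, X(s)⟩) = exp(Λ s)` with `Re Λ ≤ 0` on the cone of such `s`. Conditioning on
`T(t)` leaves `𝔼 exp(Λ (T t))`. This equals `exp(t κ(Λ))`, which is known for purely imaginary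
functionals, by holomorphic continuation in a right half-plane (Phragmén–Lindelöf), provided the
drift and the Lévy measure of `T` are carried by the same cone. For the drift this follows from weak
convergence of the laws of `m T(1/m)`, and for the Lévy measure `τ` from weak convergence of the
weighted laws `m (1 - cos⟨u, x⟩) ℙ(T(1/m) ∈ dx)` to `(1 - cos⟨u, x⟩) τ(dx)`.
-/

noncomputable section

namespace WeakSubordination

section HolomorphicIntegral

variable {α G : Type*} [MeasurableSpace α] {μ : Measure α} [NormedAddCommGroup G] [NormedSpace ℂ G]
  {F : ℂ → α → G} {U : Set ℂ}

lemma aestronglyMeasurable_deriv_param {ζ : ℂ} (hmeas : ∀ ζ, AEStronglyMeasurable (F ζ) μ)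
    (hF : ∀ᵐ x ∂μ, DifferentiableAt ℂ (F · x) ζ) :
    AEStronglyMeasurable (fun x => deriv (F · x) ζ) μ := by
  refine aestronglyMeasurable_of_tendsto_ae (𝓝[≠] (0 : ℂ))
    (f := fun h x => h⁻¹ • (F (ζ + h) x - F ζ x))
    (fun h => ((hmeas _).sub (hmeas _)).const_smul h⁻¹) ?_
  filter_upwards [hF] with x hx
  exact hx.hasDerivAt.tendsto_slope_zero

lemma differentiableAt_integral_of_dominated {ζ₀ : ℂ} {r : ℝ} (hr : 0 < r)
    (hmeas : ∀ ζ, AEStronglyMeasurable (F ζ) μ)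
    (hF : ∀ᵐ x ∂μ, DifferentiableOn ℂ (F · x) (Metric.ball ζ₀ r))
    {bound : α → ℝ} (hbound : Integrable bound μ)
    (hle : ∀ᵐ x ∂μ, ∀ ζ ∈ Metric.ball ζ₀ r, ‖F ζ x‖ ≤ bound x) :
    DifferentiableAt ℂ (fun ζ => ∫ x, F ζ x ∂μ) ζ₀ := by
  obtain ⟨s, hs, hsr⟩ : ∃ s, 0 < s ∧ s + s < r := ⟨r / 3, by linarith, by linarith⟩
  have hsub : ∀ ζ ∈ Metric.ball ζ₀ s, Metric.closedBall ζ s ⊆ Metric.ball ζ₀ r := by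
    intro ζ hζ
    exact Metric.closedBall_subset_ball' (by linarith [Metric.mem_ball.1 hζ])
  refine (hasDerivAt_integral_of_dominated_loc_of_deriv_le (𝕜 := ℂ)
    (F' := fun ζ x => deriv (F · x) ζ) (bound := fun x => bound x / s)
    (Metric.ball_mem_nhds ζ₀ hs) (Eventually.of_forall hmeas) ?_
    (aestronglyMeasurable_deriv_param hmeas ?_) ?_ (hbound.div_const s) ?_).2.differentiableAt
  · exact hbound.mono' (hmeas ζ₀) (hle.mono fun x hx => hx _ (Metric.mem_ball_self hr))
  · exact hF.mono fun x hx => hx.differentiableAt (Metric.ball_mem_nhds ζ₀ hr)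
  · filter_upwards [hF, hle] with x hx hxle ζ hζ
    exact Complex.norm_deriv_le_of_forall_mem_sphere_norm_le hs
      ((hx.mono (hsub ζ hζ)).diffContOnCl_ball subset_rfl)
      fun z hz => hxle z (hsub ζ hζ (Metric.sphere_subset_closedBall hz))
  · filter_upwards [hF] with x hx ζ hζ
    exact (hx.differentiableAt (Metric.isOpen_ball.mem_nhds
      (hsub ζ hζ (Metric.mem_closedBall_self hs.le)))).hasDerivAt

lemma diffContOnCl_integral_of_dominated (hU : IsOpen U)
    (hmeas : ∀ ζ, AEStronglyMeasurable (F ζ) μ) (hF : ∀ᵐ x ∂μ, DiffContOnCl ℂ (F · x) U)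
    (hle : ∀ ζ₀ ∈ closure U, ∃ r > 0, ∃ bound, Integrable bound μ ∧
      ∀ᵐ x ∂μ, ∀ ζ ∈ Metric.ball ζ₀ r ∩ closure U, ‖F ζ x‖ ≤ bound x) :
    DiffContOnCl ℂ (fun ζ => ∫ x, F ζ x ∂μ) U := by
  constructor
  · intro ζ₀ hζ₀
    obtain ⟨r, hr, bound, hbound, hr_le⟩ := hle ζ₀ (subset_closure hζ₀)
    obtain ⟨s, hs, hsU⟩ := Metric.isOpen_iff.1 hU ζ₀ hζ₀
    have hball : Metric.ball ζ₀ (min r s) ⊆ Metric.ball ζ₀ r ∩ U := fun ζ hζ =>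
      ⟨Metric.ball_subset_ball (min_le_left _ _) hζ,
        hsU (Metric.ball_subset_ball (min_le_right _ _) hζ)⟩
    refine (differentiableAt_integral_of_dominated (lt_min hr hs) hmeas ?_ hbound
      ?_).differentiableWithinAt
    · exact hF.mono fun x hx => hx.differentiableOn.mono fun ζ hζ => (hball hζ).2
    · exact hr_le.mono fun x hx ζ hζ => hx ζ ⟨(hball hζ).1, subset_closure (hball hζ).2⟩
  · intro ζ₀ hζ₀
    obtain ⟨r, hr, bound, hbound, hr_le⟩ := hle ζ₀ hζ₀
    refine continuousWithinAt_of_dominated (Eventually.of_forall hmeas) ?_ hbound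
      (hF.mono fun x hx => hx.continuousOn ζ₀ hζ₀)
    filter_upwards [nhdsWithin_le_nhds (Metric.ball_mem_nhds ζ₀ hr), self_mem_nhdsWithin]
      with ζ hζr hζU
    exact hr_le.mono fun x hx => hx ζ ⟨hζr, hζU⟩

lemma eqOn_right_half_plane_of_bounded {f g : ℂ → G} (hf : DiffContOnCl ℂ f {ζ | 0 < ζ.re})
    (hg : DiffContOnCl ℂ g {ζ | 0 < ζ.re}) {A B : ℝ} (hA : ∀ ζ : ℂ, 0 ≤ ζ.re → ‖f ζ‖ ≤ A)
    (hB : ∀ ζ : ℂ, 0 ≤ ζ.re → ‖g ζ‖ ≤ B) (him : ∀ y : ℝ, f (y * Complex.I) = g (y * Complex.I)) :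
    Set.EqOn f g {ζ | 0 ≤ ζ.re} := by
  have hbdd : ∀ ζ : ℂ, 0 ≤ ζ.re → ‖(f - g) ζ‖ ≤ A + B := fun ζ hζ =>
    (norm_sub_le _ _).trans (add_le_add (hA ζ hζ) (hB ζ hζ))
  intro ζ hζ
  suffices ‖(f - g) ζ‖ ≤ 0 from sub_eq_zero.1 (norm_le_zero_iff.1 this)
  refine PhragmenLindelof.right_half_plane_of_bounded_on_real (hf.sub hg) ⟨1, by norm_num, 0, ?_⟩
    ?_ (fun y => by simp [him]) hζ
  · refine Asymptotics.IsBigO.of_bound (A + B)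
      (eventually_inf_principal.2 (Eventually.of_forall fun z hz => ?_))
    simpa using hbdd z (le_of_lt hz)
  · refine isBoundedUnder_of_eventually_le (a := A + B) ?_
    filter_upwards [eventually_ge_atTop 0] with x hx
    exact hbdd x (by simpa using hx)

end HolomorphicIntegral

section Laplace

lemma norm_exp_le_one {z : ℂ} (hz : z.re ≤ 0) : ‖Complex.exp z‖ ≤ 1 := by
  rw [Complex.norm_exp]
  exact Real.exp_le_one_iff.2 hz

lemma norm_exp_sub_one_le_norm {z : ℂ} (hz : z.re ≤ 0) : ‖Complex.exp z - 1‖ ≤ ‖z‖ := by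
  have h := (convex_halfSpace_re_le 0).norm_image_sub_le_of_norm_deriv_le (𝕜 := ℂ)
    (f := Complex.exp) (C := 1) (x := 0) (y := z) (fun x _ => Complex.differentiable_exp x)
    (fun x hx => by simpa only [Complex.deriv_exp] using norm_exp_le_one hx) (by simp) hz
  simpa using h

lemma norm_exp_sub_one_le_two {z : ℂ} (hz : z.re ≤ 0) : ‖Complex.exp z - 1‖ ≤ 2 := by
  have h : ‖Complex.exp z - 1‖ ≤ ‖Complex.exp z‖ + ‖(1 : ℂ)‖ := norm_sub_le _ _
  rw [norm_one] at h
  linarith [norm_exp_le_one hz]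

lemma norm_exp_sub_one_le_min {z : ℂ} (hz : z.re ≤ 0) {c r : ℝ} (hc : 0 ≤ c) (hr : 0 ≤ r)
    (h : ‖z‖ ≤ c * r) : ‖Complex.exp z - 1‖ ≤ (2 + c) * min 1 r := by
  rcases le_total 1 r with hr1 | hr1
  · rw [min_eq_left hr1]
    linarith [norm_exp_sub_one_le_two hz]
  · rw [min_eq_right hr1]
    linarith [norm_exp_sub_one_le_norm hz, add_mul 2 c r]

section Functional

variable {E : Type*} [NormedAddCommGroup E] [NormedSpace ℝ E]

/-- The functional `ζ Re Λ + i Im Λ`: at `ζ = 1` it is `Λ`, and on the imaginary axis it is purely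
imaginary. -/
def tilt (Λ : E →L[ℝ] ℂ) (ζ : ℂ) : E →L[ℝ] ℂ :=
  ζ • (Complex.ofRealCLM ∘L Complex.reCLM ∘L Λ)
    + Complex.I • (Complex.ofRealCLM ∘L Complex.imCLM ∘L Λ)

lemma tilt_apply (Λ : E →L[ℝ] ℂ) (ζ : ℂ) (x : E) :
    tilt Λ ζ x = ζ * ((Λ x).re : ℂ) + Complex.I * ((Λ x).im : ℂ) := by
  simp [tilt]

lemma tilt_one (Λ : E →L[ℝ] ℂ) : tilt Λ 1 = Λ := by
  ext x
  rw [tilt_apply, one_mul, mul_comm Complex.I, Complex.re_add_im]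

lemma tilt_re_nonpos {Λ : E →L[ℝ] ℂ} {ζ : ℂ} {x : E} (hζ : 0 ≤ ζ.re) (hx : (Λ x).re ≤ 0) :
    (tilt Λ ζ x).re ≤ 0 := by
  simpa [tilt_apply] using mul_nonpos_of_nonneg_of_nonpos hζ hx

lemma norm_tilt_apply_le (Λ : E →L[ℝ] ℂ) (ζ : ℂ) (x : E) :
    ‖tilt Λ ζ x‖ ≤ (‖ζ‖ + 1) * ‖Λ‖ * ‖x‖ := by
  rw [tilt_apply]
  calc _ ≤ ‖ζ * ((Λ x).re : ℂ)‖ + ‖Complex.I * ((Λ x).im : ℂ)‖ := norm_add_le _ _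
    _ = ‖ζ‖ * |(Λ x).re| + |(Λ x).im| := by simp
    _ ≤ ‖ζ‖ * ‖Λ x‖ + ‖Λ x‖ := by
      gcongr
      exacts [Complex.abs_re_le_norm _, Complex.abs_im_le_norm _]
    _ = (‖ζ‖ + 1) * ‖Λ x‖ := by ring
    _ ≤ (‖ζ‖ + 1) * ‖Λ‖ * ‖x‖ := by
      rw [mul_assoc]
      gcongr
      exact Λ.le_opNorm x

variable [MeasurableSpace E] {ρ τ : Measure E} {Λ : E →L[ℝ] ℂ}

/-- The cumulant `Λ(d) + ∫ (exp(Λ(x)) - 1) τ(dx)` of a finite variation Lévy process with drift `d`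
and Lévy measure `τ`, at a complex linear functional `Λ`. -/
def cumulant (d : E) (τ : Measure E) (Λ : E →L[ℝ] ℂ) : ℂ :=
  Λ d + ∫ x, (Complex.exp (Λ x) - 1) ∂τ

lemma norm_integral_exp_le_one [IsProbabilityMeasure ρ] (hΛ : ∀ᵐ x ∂ρ, (Λ x).re ≤ 0) :
    ‖∫ x, Complex.exp (Λ x) ∂ρ‖ ≤ 1 := by
  simpa using norm_integral_le_of_norm_le_const (hΛ.mono fun x hx => norm_exp_le_one hx)

variable [BorelSpace E]

lemma integrable_exp_sub_one (hτ : Integrable (fun x => min 1 ‖x‖) τ)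
    (hΛ : ∀ᵐ x ∂τ, (Λ x).re ≤ 0) : Integrable (fun x => Complex.exp (Λ x) - 1) τ := by
  refine (hτ.const_mul (2 + ‖Λ‖)).mono' (by fun_prop) ?_
  filter_upwards [hΛ] with x hx
  exact norm_exp_sub_one_le_min hx (norm_nonneg _) (norm_nonneg _) (Λ.le_opNorm x)

lemma cumulant_re_nonpos (hτ : Integrable (fun x => min 1 ‖x‖) τ) (hΛ : ∀ᵐ x ∂τ, (Λ x).re ≤ 0)
    {d : E} (hd : (Λ d).re ≤ 0) : (cumulant d τ Λ).re ≤ 0 := by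
  rw [cumulant, Complex.add_re, ← Complex.reCLM_apply (∫ x, _ ∂τ),
    ← ContinuousLinearMap.integral_comp_comm _ (integrable_exp_sub_one hτ hΛ)]
  refine add_nonpos hd (integral_nonpos_of_ae ?_)
  filter_upwards [hΛ] with x hx
  simpa using (Complex.re_le_norm _).trans (norm_exp_le_one hx)

lemma diffContOnCl_integral_exp_tilt [IsFiniteMeasure ρ] (hΛ : ∀ᵐ x ∂ρ, (Λ x).re ≤ 0) :
    DiffContOnCl ℂ (fun ζ => ∫ x, Complex.exp (tilt Λ ζ x) ∂ρ) {ζ | 0 < ζ.re} := by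
  refine diffContOnCl_integral_of_dominated (isOpen_lt continuous_const Complex.continuous_re)
    (fun ζ => by fun_prop) (ae_of_all _ fun x => ?_)
    fun ζ₀ _ => ⟨1, one_pos, fun _ => 1, integrable_const 1, ?_⟩
  · simp only [tilt_apply]
    exact Differentiable.diffContOnCl (by fun_prop)
  · rw [Complex.closure_setOfPred_lt_re]
    filter_upwards [hΛ] with x hx ζ hζ
    exact norm_exp_le_one (tilt_re_nonpos hζ.2 hx)

lemma diffContOnCl_cumulant_tilt (hτ : Integrable (fun x => min 1 ‖x‖) τ)
    (hΛ : ∀ᵐ x ∂τ, (Λ x).re ≤ 0) (d : E) :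
    DiffContOnCl ℂ (fun ζ => cumulant d τ (tilt Λ ζ)) {ζ | 0 < ζ.re} := by
  refine .add (Differentiable.diffContOnCl ?_) (diffContOnCl_integral_of_dominated
    (isOpen_lt continuous_const Complex.continuous_re) (fun ζ => by fun_prop)
    (ae_of_all _ fun x => ?_) fun ζ₀ _ => ⟨1, one_pos,
      fun x => (2 + (‖ζ₀‖ + 1 + 1) * ‖Λ‖) * min 1 ‖x‖, hτ.const_mul _, ?_⟩)
  · simp only [tilt_apply]
    fun_prop
  · simp only [tilt_apply]
    exact Differentiable.diffContOnCl (by fun_prop)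
  · rw [Complex.closure_setOfPred_lt_re]
    filter_upwards [hΛ] with x hx ζ hζ
    have hζ₀ : ‖ζ‖ ≤ ‖ζ₀‖ + 1 := by
      linarith [norm_le_norm_add_norm_sub' ζ ζ₀, mem_ball_iff_norm.1 hζ.1]
    refine norm_exp_sub_one_le_min (tilt_re_nonpos hζ.2 hx) (by positivity) (norm_nonneg _)
      ((norm_tilt_apply_le Λ ζ x).trans ?_)
    gcongr

end Functional

section CharFun

variable {E : Type*} [NormedAddCommGroup E] [InnerProductSpace ℝ E]

/-- The functional `x ↦ i⟨θ, x⟩`. -/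
def imInner (θ : E) : E →L[ℝ] ℂ := Complex.I • (Complex.ofRealCLM ∘L innerSL ℝ θ)

lemma imInner_apply (θ x : E) : imInner θ x = Complex.I * ((inner ℝ θ x : ℝ) : ℂ) := by
  simp [imInner]

lemma imInner_re (θ x : E) : (imInner θ x).re = 0 := by
  simp [imInner_apply]

lemma exists_tilt_mul_I_eq_imInner [CompleteSpace E] (Λ : E →L[ℝ] ℂ) (y : ℝ) :
    ∃ θ : E, tilt Λ (y * Complex.I) = imInner θ := by
  refine ⟨(InnerProductSpace.toDual ℝ E).symm (y • (Complex.reCLM ∘L Λ) + Complex.imCLM ∘L Λ), ?_⟩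
  ext x
  rw [tilt_apply, imInner_apply, InnerProductSpace.toDual_symm_apply]
  simp
  ring

variable [MeasurableSpace E]

lemma charFun_eq_integral_imInner (ρ : Measure E) (θ : E) :
    charFun ρ θ = ∫ x, Complex.exp (imInner θ x) ∂ρ := by
  simp only [charFun_apply, imInner_apply, mul_comm Complex.I, real_inner_comm]

variable [BorelSpace E]

lemma integrable_exp_imInner (ρ : Measure E) [IsFiniteMeasure ρ] (θ : E) :
    Integrable (fun x => Complex.exp (imInner θ x)) ρ :=
  (integrable_const 1).mono' (by fun_prop) (ae_of_all _ fun x =>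
    norm_exp_le_one (imInner_re θ x).le)

lemma integral_exp_imInner_sub_one (ρ : Measure E) [IsProbabilityMeasure ρ] (θ : E) :
    ∫ x, (Complex.exp (imInner θ x) - 1) ∂ρ = charFun ρ θ - 1 := by
  rw [integral_sub (integrable_exp_imInner ρ θ) (integrable_const 1), charFun_eq_integral_imInner]
  simp

theorem integral_exp_eq_exp_cumulant [CompleteSpace E] {ρ τ : Measure E}
    [IsProbabilityMeasure ρ] (hτ : Integrable (fun x => min 1 ‖x‖) τ) {d : E} {t : ℝ} (ht : 0 ≤ t)
    (hchar : ∀ θ, charFun ρ θ = Complex.exp (t * cumulant d τ (imInner θ)))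
    {Λ : E →L[ℝ] ℂ} (hρΛ : ∀ᵐ x ∂ρ, (Λ x).re ≤ 0) (hτΛ : ∀ᵐ x ∂τ, (Λ x).re ≤ 0)
    (hd : (Λ d).re ≤ 0) :
    ∫ x, Complex.exp (Λ x) ∂ρ = Complex.exp (t * cumulant d τ Λ) := by
  have h : Set.EqOn (fun ζ => ∫ x, Complex.exp (tilt Λ ζ x) ∂ρ)
      (fun ζ => Complex.exp (t * cumulant d τ (tilt Λ ζ))) {ζ | 0 ≤ ζ.re} := by
    refine eqOn_right_half_plane_of_bounded (A := 1) (B := 1)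
      (diffContOnCl_integral_exp_tilt hρΛ)
      (Complex.differentiable_exp.comp_diffContOnCl
        ((diffContOnCl_cumulant_tilt hτ hτΛ d).const_smul (t : ℂ)))
      (fun ζ hζ => norm_integral_exp_le_one (hρΛ.mono fun x hx => tilt_re_nonpos hζ hx))
      (fun ζ hζ => norm_exp_le_one ?_) fun y => ?_
    · rw [Complex.re_ofReal_mul]
      exact mul_nonpos_of_nonneg_of_nonpos ht (cumulant_re_nonpos hτ
        (hτΛ.mono fun x hx => tilt_re_nonpos hζ hx) (tilt_re_nonpos hζ hd))
    · obtain ⟨θ, hθ⟩ := exists_tilt_mul_I_eq_imInner Λ y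
      simp only [hθ, ← charFun_eq_integral_imInner, hchar]
  simpa only [tilt_one] using h (by simp : (1 : ℂ) ∈ {ζ : ℂ | 0 ≤ ζ.re})

end CharFun

end Laplace

section Support

variable {E : Type*} [NormedAddCommGroup E] [InnerProductSpace ℝ E]

lemma imInner_add (θ η : E) : imInner (θ + η) = imInner θ + imInner η := by
  ext x
  simp [imInner_apply, inner_add_left, mul_add]

lemma imInner_sub (θ η : E) : imInner (θ - η) = imInner θ - imInner η := by
  ext x
  simp [imInner_apply, inner_sub_left, mul_sub]

lemma imInner_smul (r : ℝ) (θ : E) : imInner (r • θ) = r • imInner θ := by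
  ext x
  simp [imInner_apply, inner_smul_left, mul_left_comm]

lemma eq_zero_of_forall_cos_inner_eq_one {x : E} (h : ∀ u : E, Real.cos (inner ℝ u x) = 1) :
    x = 0 := by
  by_contra hx
  have h1 := h ((Real.pi / ‖x‖ ^ 2) • x)
  rw [inner_smul_left, real_inner_self_eq_norm_sq] at h1
  have h2 : Real.pi / ‖x‖ ^ 2 * ‖x‖ ^ 2 = Real.pi := div_mul_cancel₀ _ (by simpa using hx)
  norm_num [h2] at h1

variable [MeasurableSpace E]

lemma charFun_smul_measure (c : ℝ≥0∞) (σ : Measure E) (θ : E) :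
    charFun (c • σ) θ = c.toReal * charFun σ θ := by
  rw [charFun_apply, integral_smul_measure, Complex.real_smul, charFun_apply]

variable [BorelSpace E]

lemma cumulant_zero_imInner (ρ : Measure E) [IsProbabilityMeasure ρ] (θ : E) :
    cumulant 0 ρ (imInner θ) = charFun ρ θ - 1 := by
  rw [cumulant, map_zero, zero_add, integral_exp_imInner_sub_one]

lemma tendsto_inv_mul_cumulant_smul {τ : Measure E} (hτ : Integrable (fun x => min 1 ‖x‖) τ)
    {Λ : E →L[ℝ] ℂ} (hΛ : ∀ᵐ x ∂τ, (Λ x).re ≤ 0) (d : E) :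
    Tendsto (fun r : ℝ => (r : ℂ)⁻¹ * cumulant d τ (r • Λ)) atTop (𝓝 (Λ d)) := by
  have hre {r : ℝ} (hr : 0 < r) {x : E} (hx : (Λ x).re ≤ 0) : ((r • Λ) x).re ≤ 0 := by
    simpa using mul_nonpos_of_nonneg_of_nonpos hr.le hx
  have hlim : Tendsto (fun r : ℝ => ∫ x, (r : ℂ)⁻¹ * (Complex.exp ((r • Λ) x) - 1) ∂τ) atTop
      (𝓝 (∫ _, 0 ∂τ)) := by
    refine tendsto_integral_filter_of_dominated_convergence (fun x => (2 + ‖Λ‖) * min 1 ‖x‖)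
      (Eventually.of_forall fun r => by fun_prop) ?_ (hτ.const_mul _) ?_
    · filter_upwards [eventually_ge_atTop 1] with r hr
      filter_upwards [hΛ] with x hx
      have hr0 : 0 < r := by linarith
      have hle := norm_exp_sub_one_le_min (hre hr0 hx) (norm_nonneg _) (norm_nonneg _)
        ((r • Λ).le_opNorm x)
      rw [norm_mul, norm_inv, Complex.norm_of_nonneg hr0.le, inv_mul_le_iff₀ hr0]
      refine hle.trans ?_
      rw [← mul_assoc, norm_smul, Real.norm_of_nonneg hr0.le]
      gcongr
      linarith
    · filter_upwards [hΛ] with x hx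
      refine squeeze_zero_norm' (a := fun r : ℝ => r⁻¹ * 2) ?_
        (by simpa using tendsto_inv_atTop_zero.mul_const (2 : ℝ))
      filter_upwards [eventually_gt_atTop 0] with r hr
      rw [norm_mul, norm_inv, Complex.norm_of_nonneg hr.le]
      gcongr
      exact norm_exp_sub_one_le_two (hre hr hx)
  rw [integral_zero] at hlim
  refine (add_zero (Λ d) ▸ hlim.const_add (Λ d)).congr' ?_
  filter_upwards [eventually_gt_atTop 0] with r hr
  rw [integral_const_mul, cumulant, mul_add, smul_apply, Complex.real_smul,
    inv_mul_cancel_left₀ (by exact_mod_cast hr.ne')]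

/-- The measure `(1 - cos ⟨u, x⟩) σ(dx)`, whose characteristic function is a second difference of
that of `σ`; the weight makes it finite when `σ` is a Lévy measure. -/
def cosWeighted (u : E) (σ : Measure E) : Measure E :=
  σ.withDensity fun x => ENNReal.ofReal (1 - Real.cos (inner ℝ u x))

lemma charFun_cosWeighted {σ : Measure E} (hσ : Integrable (fun x => min 1 ‖x‖) σ) (d u θ : E) :
    charFun (cosWeighted u σ) θ = cumulant d σ (imInner θ)
      - (cumulant d σ (imInner (θ + u)) + cumulant d σ (imInner (θ - u))) / 2 := by
  have hint (η : E) : Integrable (fun x => Complex.exp (imInner η x) - 1) σ :=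
    integrable_exp_sub_one hσ (ae_of_all _ fun x => (imInner_re η x).le)
  have hcos (x : E) : (1 - Real.cos (inner ℝ u x)) • Complex.exp (imInner θ x)
      = (Complex.exp (imInner θ x) - 1)
        - ((Complex.exp (imInner (θ + u) x) - 1) + (Complex.exp (imInner (θ - u) x) - 1)) / 2 := by
    rw [imInner_add, imInner_sub, add_apply, sub_apply,
      sub_eq_add_neg (imInner θ x), Complex.exp_add, Complex.exp_add, imInner_apply u,
      mul_comm Complex.I (inner ℝ u x : ℂ), ← neg_mul, Complex.exp_mul_I, Complex.exp_mul_I,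
      Complex.cos_neg, Complex.sin_neg, Complex.real_smul]
    push_cast
    ring
  rw [charFun_eq_integral_imInner, cosWeighted, integral_withDensity_eq_integral_toReal_smul
    (by fun_prop) (ae_of_all _ fun x => ENNReal.ofReal_lt_top)]
  simp only [ENNReal.toReal_ofReal (sub_nonneg.2 (Real.cos_le_one _)), hcos, cumulant]
  have hhalf : Integrable (fun x => ((Complex.exp (imInner (θ + u) x) - 1)
      + (Complex.exp (imInner (θ - u) x) - 1)) / 2) σ := ((hint _).add (hint _)).div_const 2
  rw [integral_sub (hint θ) hhalf, integral_div,
    integral_add (hint _) (hint _), imInner_add, imInner_sub]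
  simp only [add_apply, sub_apply]
  ring

lemma isFiniteMeasure_cosWeighted {σ : Measure E} (hσ : Integrable (fun x => min 1 ‖x‖) σ) (u : E) :
    IsFiniteMeasure (cosWeighted u σ) := by
  refine isFiniteMeasure_withDensity_ofReal (Integrable.hasFiniteIntegral ?_)
  refine (hσ.const_mul (2 + ‖imInner u‖)).mono' (by fun_prop) (ae_of_all _ fun x => ?_)
  have hre := (Complex.abs_re_le_norm _).trans (norm_exp_sub_one_le_min (imInner_re u x).le
    (norm_nonneg _) (norm_nonneg _) ((imInner u).le_opNorm x))
  simpa [imInner_apply, Complex.exp_re, abs_sub_comm] using hre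

section FiniteDimensional

variable [FiniteDimensional ℝ E] {K : Set E}

lemma ae_mem_of_tendsto_charFun {ρ : ℕ → Measure E} [∀ m, IsProbabilityMeasure (ρ m)]
    {ρ₀ : Measure E} [IsProbabilityMeasure ρ₀]
    (h : ∀ θ, Tendsto (fun m => charFun (ρ m) θ) atTop (𝓝 (charFun ρ₀ θ))) (hK : IsClosed K)
    (hρK : ∀ m, ∀ᵐ x ∂ρ m, x ∈ K) : ∀ᵐ x ∂ρ₀, x ∈ K := by
  let law (m : ℕ) : ProbabilityMeasure E := ⟨ρ m, inferInstance⟩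
  let law₀ : ProbabilityMeasure E := ⟨ρ₀, inferInstance⟩
  have hlim : Tendsto law atTop (𝓝 law₀) := ProbabilityMeasure.tendsto_of_tendsto_charFun h
  have hle := ProbabilityMeasure.limsup_measure_closed_le_of_tendsto hlim hK
  have hone (m : ℕ) : ρ m K = 1 := (mem_ae_iff_prob_eq_one hK.measurableSet).1 (hρK m)
  simp only [law, law₀, ProbabilityMeasure.coe_mk, hone, limsup_const] at hle
  exact (mem_ae_iff_prob_eq_one hK.measurableSet).2 (le_antisymm prob_le_one hle)

lemma ae_mem_of_tendsto_charFun_of_isFiniteMeasure {σ : ℕ → Measure E}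
    [∀ m, IsFiniteMeasure (σ m)] {σ₀ : Measure E} [IsFiniteMeasure σ₀]
    (h : ∀ θ, Tendsto (fun m => charFun (σ m) θ) atTop (𝓝 (charFun σ₀ θ))) (hK : IsClosed K)
    (hσK : ∀ m, ∀ᵐ x ∂σ m, x ∈ K) : ∀ᵐ x ∂σ₀, x ∈ K := by
  rcases eq_or_ne σ₀ 0 with rfl | hσ₀
  · simp
  have : NeZero σ₀ := ⟨hσ₀⟩
  have hmass : Tendsto (fun m => (σ m).real Set.univ) atTop (𝓝 (σ₀.real Set.univ)) := by
    simpa only [charFun_zero, Complex.ofReal_re, Function.comp_def] using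
      (Complex.continuous_re.tendsto _).comp (h 0)
  obtain ⟨N, hN⟩ := eventually_atTop.1 (hmass.eventually_const_lt measureReal_univ_pos)
  have (m : ℕ) : NeZero (σ (m + N)) := ⟨fun h0 => by simpa [h0] using hN (m + N) (by omega)⟩
  have hchar (θ : E) : Tendsto (fun m => charFun ((σ (m + N) Set.univ)⁻¹ • σ (m + N)) θ) atTop
      (𝓝 (charFun ((σ₀ Set.univ)⁻¹ • σ₀) θ)) := by
    simp only [charFun_smul_measure, ENNReal.toReal_inv]
    exact ((Complex.continuous_ofReal.tendsto _).comp
      ((hmass.inv₀ measureReal_univ_pos.ne').comp (tendsto_add_atTop_nat N))).mul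
      ((h θ).comp (tendsto_add_atTop_nat N))
  have hae := ae_mem_of_tendsto_charFun hchar hK fun m => Measure.ae_smul_measure (hσK _) _
  exact (Measure.ae_ennreal_smul_measure_iff (ENNReal.inv_ne_zero.2 (measure_ne_top _ _))).1 hae

variable {ρ : ℝ≥0 → Measure E} [∀ t, IsProbabilityMeasure (ρ t)] {τ : Measure E} {d : E}

lemma drift_mem_of_forall_ae_mem (hτ : Integrable (fun x => min 1 ‖x‖) τ)
    (hchar : ∀ t θ, charFun (ρ t) θ = Complex.exp (t * cumulant d τ (imInner θ)))
    (hK : IsClosed K) (hcone : ∀ c : ℝ, 0 < c → ∀ x ∈ K, c • x ∈ K)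
    (hρK : ∀ t, ∀ᵐ x ∂ρ t, x ∈ K) : d ∈ K := by
  let scaled (m : ℕ) : Measure E := (ρ (m + 1)⁻¹).map ((m + 1 : ℝ) • ·)
  have hprob (m : ℕ) : IsProbabilityMeasure (scaled m) :=
    Measure.isProbabilityMeasure_map (by fun_prop)
  have hlim (θ : E) : Tendsto (fun m => charFun (scaled m) θ) atTop
      (𝓝 (charFun (Measure.dirac d) θ)) := by
    have h := ((tendsto_inv_mul_cumulant_smul hτ
      (ae_of_all _ fun x => (imInner_re θ x).le) d).comp
      (tendsto_atTop_add_const_right _ 1 tendsto_natCast_atTop_atTop)).cexp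
    rw [charFun_eq_integral_imInner, integral_dirac]
    refine h.congr fun m => ?_
    simp only [scaled, charFun_map_smul, hchar, imInner_smul, Function.comp_apply]
    push_cast
    rfl
  have hdirac := ae_mem_of_tendsto_charFun hlim hK fun m =>
    (ae_map_iff (by fun_prop) hK.measurableSet).2
      ((hρK _).mono fun x => hcone _ (by positivity) x)
  exact (ae_dirac_iff hK.measurableSet).1 hdirac

lemma tendsto_mul_exp_div_sub_one (z : ℂ) :
    Tendsto (fun m : ℕ => (m + 1 : ℂ) * (Complex.exp ((m + 1 : ℂ)⁻¹ * z) - 1)) atTop (𝓝 z) := by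
  have hderiv : HasDerivAt (fun s : ℂ => Complex.exp (s * z)) z 0 := by
    simpa using ((hasDerivAt_id (0 : ℂ)).mul_const z).cexp
  have hinv : Tendsto (fun m : ℕ => (m + 1 : ℂ)⁻¹) atTop (𝓝[≠] 0) := by
    refine tendsto_nhdsWithin_iff.2 ⟨?_, Eventually.of_forall fun m => ?_⟩
    · simpa using tendsto_one_div_add_atTop_nhds_zero_nat (𝕜 := ℂ)
    · exact inv_ne_zero (by exact_mod_cast m.succ_ne_zero)
  simpa [Function.comp_def] using hderiv.tendsto_slope_zero.comp hinv

lemma ae_cosWeighted_mem (hτ : Integrable (fun x => min 1 ‖x‖) τ)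
    (hchar : ∀ t θ, charFun (ρ t) θ = Complex.exp (t * cumulant d τ (imInner θ)))
    (hK : IsClosed K) (hρK : ∀ t, ∀ᵐ x ∂ρ t, x ∈ K) (u : E) : ∀ᵐ x ∂cosWeighted u τ, x ∈ K := by
  have hρ (t : ℝ≥0) : Integrable (fun x => min 1 ‖x‖) (ρ t) :=
    (integrable_const (1 : ℝ)).mono' (by fun_prop) (ae_of_all _ fun x => by simp [abs_of_nonneg])
  have := isFiniteMeasure_cosWeighted hτ u
  have (t : ℝ≥0) := isFiniteMeasure_cosWeighted (hρ t) u
  let scaled (m : ℕ) : Measure E := ((m + 1 : ℝ≥0) : ℝ≥0∞) • cosWeighted u (ρ (m + 1)⁻¹)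
  have hfin (m : ℕ) : IsFiniteMeasure (scaled m) := Measure.smul_finite _ ENNReal.coe_ne_top
  refine ae_mem_of_tendsto_charFun_of_isFiniteMeasure (σ := scaled) (fun θ => ?_) hK fun m =>
    Measure.ae_smul_measure ((withDensity_absolutelyContinuous _ _).ae_le (hρK _)) _
  rw [charFun_cosWeighted hτ d]
  refine (((tendsto_mul_exp_div_sub_one _).sub (((tendsto_mul_exp_div_sub_one _).add
    (tendsto_mul_exp_div_sub_one _)).div_const 2))).congr fun m => ?_
  simp only [scaled, charFun_smul_measure, charFun_cosWeighted (hρ _) 0, cumulant_zero_imInner,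
    hchar, ENNReal.coe_toReal]
  push_cast
  ring

lemma levyMeasure_ae_mem_of_forall_ae_mem (hτ : Integrable (fun x => min 1 ‖x‖) τ)
    (hchar : ∀ t θ, charFun (ρ t) θ = Complex.exp (t * cumulant d τ (imInner θ)))
    (hK : IsClosed K) (h0 : 0 ∈ K) (hρK : ∀ t, ∀ᵐ x ∂ρ t, x ∈ K) : ∀ᵐ x ∂τ, x ∈ K := by
  have hdense : ∀ᵐ x ∂τ, ∀ n, 1 - Real.cos (inner ℝ (TopologicalSpace.denseSeq E n) x) ≠ 0 →
      x ∈ K := by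
    refine ae_all_iff.2 fun n => ?_
    filter_upwards [(ae_withDensity_iff (by fun_prop)).1
      (ae_cosWeighted_mem hτ hchar hK hρK (TopologicalSpace.denseSeq E n))] with x hx hcos
    exact hx (ENNReal.ofReal_pos.2 ((sub_nonneg.2 (Real.cos_le_one _)).lt_of_ne' hcos)).ne'
  filter_upwards [hdense] with x hx
  by_contra hxK
  have hcos : (fun u => Real.cos (inner ℝ u x)) = fun _ : E => 1 :=
    (TopologicalSpace.denseRange_denseSeq E).equalizer (by fun_prop) continuous_const
      (funext fun n => by
        by_contra h
        exact hxK (hx n (sub_ne_zero.2 (Ne.symm h))))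
  exact hxK (eq_zero_of_forall_cos_inner_eq_one (congrFun hcos) ▸ h0)

end FiniteDimensional

end Support

section Projection

variable {ι : Type*}

lemma proj_apply (J : Set ι) [DecidablePred (· ∈ J)] (x : EuclideanSpace ℝ ι) (i : ι) :
    proj J x i = if i ∈ J then x i else 0 := by
  simp only [proj, Set.indicator_apply]

lemma proj_univ (x : EuclideanSpace ℝ ι) : proj Set.univ x = x := by
  simp [proj]

@[fun_prop]
lemma measurable_proj (J : Set ι) : Measurable (proj J) := by
  classical
  refine (WithLp.measurable_toLp 2 _).comp (measurable_pi_lambda _ fun k => ?_)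
  simp only [Set.indicator_apply]
  split_ifs <;> fun_prop

variable [Fintype ι]

lemma inner_proj (J : Set ι) (x y : EuclideanSpace ℝ ι) :
    inner ℝ (proj J x) y = inner ℝ x (proj J y) := by
  classical
  simp [PiLp.inner_apply, proj_apply]

lemma norm_proj_le (J : Set ι) (x : EuclideanSpace ℝ ι) : ‖proj J x‖ ≤ ‖x‖ := by
  classical
  rw [EuclideanSpace.norm_eq, EuclideanSpace.norm_eq]
  gcongr with i
  rw [proj_apply]
  split_ifs <;> simp

lemma charFun_map_proj (ρ : Measure (EuclideanSpace ℝ ι)) (J : Set ι) (θ : EuclideanSpace ℝ ι) :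
    charFun (ρ.map (proj J)) θ = charFun ρ (proj J θ) := by
  rw [charFun_apply, charFun_apply, integral_map (by fun_prop) (by fun_prop)]
  simp only [inner_proj]

end Projection

section MonotoneCone

variable {n : ℕ}

/-- The cone `{0 ≤ s₁ ≤ … ≤ sₙ}`, in which a subordinator with monotone components lives. -/
def monotoneCone (n : ℕ) : Set (EuclideanSpace ℝ (Fin n)) :=
  {s | (∀ k, 0 ≤ s k) ∧ Monotone fun k => s k}

lemma isClosed_monotoneCone : IsClosed (monotoneCone n) := by
  have h : monotoneCone n = (⋂ k, {s | 0 ≤ s k}) ∩ ⋂ (k) (l) (_ : k ≤ l), {s | s k ≤ s l} := by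
    ext s
    simp [monotoneCone, Monotone]
  rw [h]
  exact (isClosed_iInter fun k => isClosed_le (by fun_prop) (by fun_prop)).inter
    (isClosed_iInter fun k => isClosed_iInter fun l => isClosed_iInter fun _ =>
      isClosed_le (by fun_prop) (by fun_prop))

lemma zero_mem_monotoneCone : (0 : EuclideanSpace ℝ (Fin n)) ∈ monotoneCone n :=
  ⟨fun _ => le_rfl, fun _ _ _ => le_rfl⟩

lemma smul_mem_monotoneCone (c : ℝ) (hc : 0 < c) (s : EuclideanSpace ℝ (Fin n))
    (hs : s ∈ monotoneCone n) : c • s ∈ monotoneCone n :=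
  ⟨fun k => mul_nonneg hc.le (hs.1 k), fun _ _ h => mul_le_mul_of_nonneg_left (hs.2 h) hc.le⟩

/-- The functional `s ↦ sⱼ - sⱼ₋₁`, where `s₀ = 0`. -/
def increment (j : Fin n) : EuclideanSpace ℝ (Fin n) →L[ℝ] ℝ :=
  EuclideanSpace.proj j -
    (Fin.cons 0 EuclideanSpace.proj : Fin (n + 1) → EuclideanSpace ℝ (Fin n) →L[ℝ] ℝ) j.castSucc

lemma increment_eq_cons_sub (j : Fin n) (s : EuclideanSpace ℝ (Fin n)) :
    increment j s = (Fin.cons 0 s : Fin (n + 1) → ℝ) j.succ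
      - (Fin.cons 0 s : Fin (n + 1) → ℝ) j.castSucc := by
  rw [increment, sub_apply, Fin.cons_succ]
  cases j.castSucc using Fin.cases <;> simp

lemma monotone_cons_zero {s : EuclideanSpace ℝ (Fin n)} (hs : s ∈ monotoneCone n) :
    Monotone (Fin.cons 0 s : Fin (n + 1) → ℝ) := by
  intro i j hij
  cases i using Fin.cases with
  | zero => cases j using Fin.cases <;> simp [hs.1]
  | succ i =>
    cases j using Fin.cases with
    | zero => simp at hij
    | succ j => simpa using hs.2 (Fin.succ_le_succ_iff.1 hij)

lemma increment_nonneg {s : EuclideanSpace ℝ (Fin n)} (hs : s ∈ monotoneCone n) (j : Fin n) :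
    0 ≤ increment j s := by
  rw [increment_eq_cons_sub]
  exact sub_nonneg.2 (monotone_cons_zero hs j.castSucc_lt_succ.le)

lemma sum_increment (s : EuclideanSpace ℝ (Fin n)) (k : Fin n) :
    ∑ j ∈ Finset.Iic k, increment j s = s k := by
  simp_rw [increment_eq_cons_sub]
  rw [Fin.sum_Iic_sub, Fin.cons_succ, Fin.cons_zero, sub_zero]

end MonotoneCone

section DiamondExponent

variable {n : ℕ} {s : EuclideanSpace ℝ (Fin n)}

/-- The times `0, s₁, …, sₙ`. -/
def timeGrid (s : EuclideanSpace ℝ (Fin n)) : Fin (n + 1) → ℝ≥0 :=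
  Fin.cons 0 fun k => (s k).toNNReal

lemma coe_timeGrid (hs : s ∈ monotoneCone n) (k : Fin (n + 1)) :
    (timeGrid s k : ℝ) = (Fin.cons 0 s : Fin (n + 1) → ℝ) k := by
  cases k using Fin.cases <;> simp [timeGrid, hs.1]

lemma monotone_timeGrid (hs : s ∈ monotoneCone n) : Monotone (timeGrid s) := fun i j hij => by
  rw [← NNReal.coe_le_coe, coe_timeGrid hs, coe_timeGrid hs]
  exact monotone_cons_zero hs hij

lemma coe_timeGrid_sub (hs : s ∈ monotoneCone n) (j : Fin n) :
    ((timeGrid s j.succ - timeGrid s j.castSucc : ℝ≥0) : ℝ) = increment j s := by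
  rw [NNReal.coe_sub (monotone_timeGrid hs j.castSucc_lt_succ.le), coe_timeGrid hs,
    coe_timeGrid hs, increment_eq_cons_sub]

lemma evalAt_eq_sum_proj {Ω : Type*} {X : ℝ≥0 → Ω → EuclideanSpace ℝ (Fin n)} {ω : Ω}
    (hω : X 0 ω = 0) (s : EuclideanSpace ℝ (Fin n)) :
    evalAt X s ω
      = ∑ j, proj (Set.Ici j) (X (timeGrid s j.succ) ω - X (timeGrid s j.castSucc) ω) := by
  ext k
  have h := Fin.sum_Iic_sub k fun j => X (timeGrid s j) ω k
  simp only [timeGrid, Fin.cons_zero, Fin.cons_succ, hω, PiLp.zero_apply, sub_zero] at h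
  rw [WithLp.ofLp_sum, Finset.sum_apply]
  simp only [proj_apply, Set.mem_Ici, ← Finset.sum_filter, Finset.filter_ge_eq_Iic]
  exact h.symm

/-- The real-linear map with value `∑ⱼ (sⱼ - sⱼ₋₁) Ψ(π_{{j, …, n}} θ)` at `s`, where `Ψ` is the
Lévy exponent. On the monotone cone it is the logarithm of the characteristic function of `X(s)`
at `θ`. -/
def diamondExponent (μ : EuclideanSpace ℝ (Fin n)) (C : Matrix (Fin n) (Fin n) ℝ)
    (ν : Measure (EuclideanSpace ℝ (Fin n))) (θ : EuclideanSpace ℝ (Fin n)) :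
    EuclideanSpace ℝ (Fin n) →L[ℝ] ℂ :=
  ∑ j, levyExponent μ C ν (proj (Set.Ici j) θ) • (Complex.ofRealCLM ∘L increment j)

lemma diamondExponent_apply (μ : EuclideanSpace ℝ (Fin n)) (C : Matrix (Fin n) (Fin n) ℝ)
    (ν : Measure (EuclideanSpace ℝ (Fin n))) (θ s : EuclideanSpace ℝ (Fin n)) :
    diamondExponent μ C ν θ s
      = ∑ j, (increment j s : ℂ) * levyExponent μ C ν (proj (Set.Ici j) θ) := by
  simp [diamondExponent, mul_comm]

variable {Ω : Type*} [MeasurableSpace Ω] {P : Measure Ω} {X : ℝ≥0 → Ω → EuclideanSpace ℝ (Fin n)}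
  {μ : EuclideanSpace ℝ (Fin n)} {C : Matrix (Fin n) (Fin n) ℝ}
  {ν : Measure (EuclideanSpace ℝ (Fin n))}

lemma measurable_evalAt {ι : Type*} {X : ℝ≥0 → Ω → EuclideanSpace ℝ ι}
    (hX : ∀ t, Measurable (X t)) (s : EuclideanSpace ℝ ι) :
    Measurable (evalAt X s) := by
  refine (WithLp.measurable_toLp 2 _).comp (measurable_pi_lambda _ fun k => ?_)
  fun_prop

lemma charFun_map_sub (hX : HasTriplet X P μ C ν) {r t : ℝ≥0} (hrt : r ≤ t)
    (θ : EuclideanSpace ℝ (Fin n)) :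
    charFun (P.map fun ω => X t ω - X r ω) θ
      = Complex.exp (((t - r : ℝ≥0) : ℂ) * levyExponent μ C ν θ) := by
  have h := (hX.isLevyProcess.stationary r (t - r)).map_eq
  rw [add_tsub_cancel_of_le hrt] at h
  rw [h, hX.charFun_eq]

lemma charFun_map_evalAt (hX : HasTriplet X P μ C ν) (hs : s ∈ monotoneCone n)
    (θ : EuclideanSpace ℝ (Fin n)) :
    charFun (P.map (evalAt X s)) θ = Complex.exp (diamondExponent μ C ν θ s) := by
  have hXm := hX.isLevyProcess.measurable
  set Y : Fin n → Ω → EuclideanSpace ℝ (Fin n) := fun j ω =>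
    X (timeGrid s j.succ) ω - X (timeGrid s j.castSucc) ω
  have hYm (j : Fin n) : Measurable (Y j) := (hXm _).sub (hXm _)
  have hindep : iIndepFun (fun j ω => proj (Set.Ici j) (Y j ω)) P :=
    (hX.isLevyProcess.indep n _ (monotone_timeGrid hs)).comp _ fun j => measurable_proj _
  have hsum : evalAt X s =ᵐ[P] fun ω => ∑ j, proj (Set.Ici j) (Y j ω) := by
    filter_upwards [hX.isLevyProcess.zero] with ω hω using evalAt_eq_sum_proj hω s
  have hfactor (j : Fin n) : charFun (P.map fun ω => proj (Set.Ici j) (Y j ω)) θ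
      = Complex.exp (increment j s * levyExponent μ C ν (proj (Set.Ici j) θ)) := by
    change charFun (P.map (proj (Set.Ici j) ∘ Y j)) θ = _
    rw [← Measure.map_map (measurable_proj _) (hYm j), charFun_map_proj,
      charFun_map_sub hX (monotone_timeGrid hs j.castSucc_lt_succ.le), ← coe_timeGrid_sub hs]
  rw [Measure.map_congr hsum, hindep.charFun_map_fun_sum_eq_prod (by fun_prop),
    Finset.prod_apply, Finset.prod_congr rfl fun j _ => hfactor j, ← Complex.exp_sum,
    diamondExponent_apply]

lemma diamondExponent_re_nonpos [IsProbabilityMeasure P] (hX : HasTriplet X P μ C ν)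
    (hs : s ∈ monotoneCone n) (θ : EuclideanSpace ℝ (Fin n)) :
    (diamondExponent μ C ν θ s).re ≤ 0 := by
  rw [← Real.exp_le_one_iff, ← Complex.norm_exp, ← charFun_map_evalAt hX hs]
  have := Measure.isProbabilityMeasure_map (μ := P)
    (measurable_evalAt hX.isLevyProcess.measurable s).aemeasurable
  exact norm_charFun_le_one _

end DiamondExponent

section Pair

variable {ι : Type*}

lemma exists_eq_pair (θ : EuclideanSpace ℝ (ι ⊕ ι)) : ∃ θ₁ θ₂, θ = pair θ₁ θ₂ :=
  ⟨WithLp.toLp 2 (θ ∘ Sum.inl), WithLp.toLp 2 (θ ∘ Sum.inr), by ext (_ | _) <;> rfl⟩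

lemma pair_add_pair (a b x y : EuclideanSpace ℝ ι) :
    pair a b + pair x y = pair (a + x) (b + y) := by
  ext (_ | _) <;> rfl

lemma measurable_pair {α : Type*} [MeasurableSpace α] {f g : α → EuclideanSpace ℝ ι}
    (hf : Measurable f) (hg : Measurable g) : Measurable fun a => pair (f a) (g a) := by
  refine (WithLp.measurable_toLp 2 _).comp (measurable_pi_lambda _ fun k => ?_)
  cases k <;> simp only [Sum.elim_inl, Sum.elim_inr] <;> fun_prop

variable [Fintype ι]

lemma norm_pair_zero (x : EuclideanSpace ℝ ι) : ‖pair 0 x‖ = ‖x‖ := by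
  simp [EuclideanSpace.norm_eq, pair, Fintype.sum_sum_type]

lemma inner_pair (a b x y : EuclideanSpace ℝ ι) :
    inner ℝ (pair a b) (pair x y) = inner ℝ a x + inner ℝ b y := by
  simp [pair, PiLp.inner_apply, Fintype.sum_sum_type]

lemma imInner_pair (a b x y : EuclideanSpace ℝ ι) :
    imInner (pair a b) (pair x y) = imInner a x + imInner b y := by
  simp only [imInner_apply, inner_pair]
  push_cast
  ring

lemma charFun_map_pair {Ω : Type*} [MeasurableSpace Ω] {P : Measure Ω} {Y : Ω → EuclideanSpace ℝ ι}
    (hY : Measurable Y) (s θ₁ θ₂ : EuclideanSpace ℝ ι) :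
    charFun (P.map fun ω => pair s (Y ω)) (pair θ₁ θ₂)
      = Complex.exp (imInner θ₁ s) * charFun (P.map Y) θ₂ := by
  have hpair : Measurable fun ω => pair s (Y ω) := measurable_pair measurable_const hY
  rw [charFun_eq_integral_imInner, charFun_eq_integral_imInner,
    integral_map hpair.aemeasurable (by fun_prop), integral_map hY.aemeasurable (by fun_prop),
    ← integral_const_mul]
  simp_rw [imInner_pair, Complex.exp_add]

variable {α : Type*} [MeasurableSpace α] {ρ : Measure α} {f g : α → EuclideanSpace ℝ ι}

lemma integrable_pair_iff :
    Integrable (fun a => pair (f a) (g a)) ρ ↔ Integrable f ρ ∧ Integrable g ρ := by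
  simp only [integrable_piLp_iff, Sum.forall, pair, Sum.elim_inl, Sum.elim_inr]

lemma integral_pair (h : Integrable (fun a => pair (f a) (g a)) ρ) :
    ∫ a, pair (f a) (g a) ∂ρ = pair (∫ a, f a ∂ρ) (∫ a, g a ∂ρ) := by
  obtain ⟨hf, hg⟩ := integrable_pair_iff.1 h
  ext (i | i)
  · rw [eval_integral_piLp h.eval_piLp]
    exact (eval_integral_piLp hf.eval_piLp i).symm
  · rw [eval_integral_piLp h.eval_piLp]
    exact (eval_integral_piLp hg.eval_piLp i).symm

end Pair

section SampledPath

variable {E : Type*} [TopologicalSpace E]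

/-- The point of the grid of mesh `1 / (m + 1)` directly to the right of `t`. -/
def gridCeil (m : ℕ) (t : ℝ≥0) : ℝ≥0 := (⌊(m + 1) * t⌋₊ + 1) / (m + 1)

lemma lt_gridCeil (m : ℕ) (t : ℝ≥0) : t < gridCeil m t := by
  rw [gridCeil, lt_div_iff₀ (by positivity), mul_comm]
  exact Nat.lt_floor_add_one _

lemma gridCeil_le (m : ℕ) (t : ℝ≥0) : gridCeil m t ≤ t + 1 / (m + 1) := by
  rw [gridCeil, add_div]
  gcongr
  rw [div_le_iff₀ (by positivity), mul_comm]
  exact Nat.floor_le zero_le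

lemma tendsto_gridCeil (t : ℝ≥0) : Tendsto (fun m => gridCeil m t) atTop (𝓝[≥] t) := by
  have h : Tendsto (fun m : ℕ => t + 1 / ((m : ℝ≥0) + 1)) atTop (𝓝 (t + 0)) :=
    tendsto_const_nhds.add tendsto_one_div_add_atTop_nhds_zero_nat
  rw [add_zero] at h
  exact tendsto_nhdsWithin_iff.2 ⟨tendsto_of_tendsto_of_tendsto_of_le_of_le tendsto_const_nhds h
    (fun m => (lt_gridCeil m t).le) fun m => gridCeil_le m t,
    .of_forall fun m => (lt_gridCeil m t).le⟩

/-- The right limit of a path, sampled along the grids `gridCeil`. In contrast to `x t`, it is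
jointly measurable in the time and the path. -/
def gridLim [Nonempty E] (t : ℝ≥0) (x : ℝ≥0 → E) : E :=
  limUnder atTop fun m => x (gridCeil m t)

lemma gridLim_eq [T2Space E] [Nonempty E] {x : ℝ≥0 → E} {t : ℝ≥0}
    (h : ContinuousWithinAt x (Set.Ici t) t) : gridLim t x = x t :=
  (h.tendsto.comp (tendsto_gridCeil t)).limUnder_eq

lemma measurable_gridLim [PolishSpace E] [MeasurableSpace E] [BorelSpace E] [Nonempty E] :
    Measurable fun p : ℝ≥0 × (ℝ≥0 → E) => gridLim p.1 p.2 := by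
  refine (StronglyMeasurable.limUnder fun m => Measurable.stronglyMeasurable ?_).measurable
  have hsample : Measurable fun q : ℕ × (ℝ≥0 → E) => q.2 ((q.1 + 1) / (m + 1)) :=
    measurable_from_prod_countable_right fun i =>
      measurable_pi_apply (((i : ℝ≥0) + 1) / (m + 1))
  have hfloor : Measurable fun p : ℝ≥0 × (ℝ≥0 → E) => ⌊(m + 1) * p.1⌋₊ :=
    Nat.measurable_floor.comp (by fun_prop)
  exact hsample.comp (hfloor.prodMk measurable_snd)

end SampledPath

section EvalKernel

variable {ι : Type*}

lemma evalAt_gridLim {Ω : Type*} {X : ℝ≥0 → Ω → EuclideanSpace ℝ ι} {ω : Ω}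
    (hω : IsCadlag fun t => X t ω) (s : EuclideanSpace ℝ ι) :
    evalAt gridLim s (fun t => X t ω) = evalAt X s ω := by
  simp only [evalAt, gridLim_eq (hω.1 _)]

lemma measurable_evalAt_gridLim [Finite ι] :
    Measurable fun p : EuclideanSpace ℝ ι × (ℝ≥0 → EuclideanSpace ℝ ι) =>
      evalAt gridLim p.1 p.2 := by
  cases nonempty_fintype ι
  refine (WithLp.measurable_toLp 2 _).comp (measurable_pi_lambda _ fun k => ?_)
  have hlim : Measurable fun p : EuclideanSpace ℝ ι × (ℝ≥0 → EuclideanSpace ℝ ι) =>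
      gridLim (p.1 k).toNNReal p.2 :=
    measurable_gridLim.comp (.prodMk (by fun_prop) measurable_snd)
  fun_prop

lemma measurable_pair_evalAt_gridLim [Finite ι] :
    Measurable fun p : EuclideanSpace ℝ ι × (ℝ≥0 → EuclideanSpace ℝ ι) =>
      pair p.1 (evalAt gridLim p.1 p.2) :=
  measurable_pair measurable_fst measurable_evalAt_gridLim

variable [Fintype ι] {Ω : Type*} [MeasurableSpace Ω] {P : Measure Ω}
  {X : ℝ≥0 → Ω → EuclideanSpace ℝ ι} {S : Ω → EuclideanSpace ℝ ι}

/-- The kernel `s ↦ law of (s, X(s))`. The path of `X` is resampled by `gridLim`, which changes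
nothing for càdlàg paths and makes the law measurable in `s`. -/
def evalKernel (X : ℝ≥0 → Ω → EuclideanSpace ℝ ι) (P : Measure Ω) :
    Kernel (EuclideanSpace ℝ ι) (EuclideanSpace ℝ (ι ⊕ ι)) :=
  (Kernel.id ×ₖ Kernel.const _ (P.map fun ω t => X t ω)).map
    fun p => pair p.1 (evalAt gridLim p.1 p.2)

lemma IsLevyProcess.measurable_path (hX : IsLevyProcess X P) : Measurable fun ω t => X t ω :=
  measurable_pi_lambda _ hX.measurable

lemma pair_evalAt_gridLim_ae_eq (hX : IsLevyProcess X P) (S : Ω → EuclideanSpace ℝ ι) :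
    (fun ω => pair (S ω) (evalAt gridLim (S ω) fun t => X t ω))
      =ᵐ[P] fun ω => pair (S ω) (evalAt X (S ω) ω) := by
  filter_upwards [hX.cadlag] with ω hω
  rw [evalAt_gridLim hω]

lemma aemeasurable_pair_evalAt (hX : IsLevyProcess X P) (hS : Measurable S) :
    AEMeasurable (fun ω => pair (S ω) (evalAt X (S ω) ω)) P :=
  (measurable_pair_evalAt_gridLim.comp (hS.prodMk hX.measurable_path)).aemeasurable.congr
    (pair_evalAt_gridLim_ae_eq hX S)

variable [IsProbabilityMeasure P]

lemma evalKernel_apply (hX : IsLevyProcess X P) (s : EuclideanSpace ℝ ι) :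
    evalKernel X P s = P.map fun ω => pair s (evalAt X s ω) := by
  rw [evalKernel, Kernel.map_apply _ measurable_pair_evalAt_gridLim, Kernel.prod_apply,
    Kernel.id_apply, Kernel.const_apply, Measure.dirac_prod,
    Measure.map_map measurable_pair_evalAt_gridLim measurable_prodMk_left,
    Measure.map_map (measurable_pair_evalAt_gridLim.comp measurable_prodMk_left)
      hX.measurable_path]
  refine Measure.map_congr ?_
  filter_upwards [hX.cadlag] with ω hω
  simp only [Function.comp_apply, evalAt_gridLim hω]

lemma isMarkovKernel_evalKernel (hX : IsLevyProcess X P) : IsMarkovKernel (evalKernel X P) :=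
  ⟨fun s => by
    rw [evalKernel_apply hX]
    exact Measure.isProbabilityMeasure_map
      (measurable_pair measurable_const (measurable_evalAt hX.measurable s)).aemeasurable⟩

lemma map_pair_evalAt (hX : IsLevyProcess X P) (hS : Measurable S)
    (hSX : IndepFun S (fun ω t => X t ω) P) :
    P.map (fun ω => pair (S ω) (evalAt X (S ω) ω)) = evalKernel X P ∘ₘ P.map S := by
  rw [← Measure.map_congr (pair_evalAt_gridLim_ae_eq hX S), evalKernel,
    ← Measure.map_comp _ _ measurable_pair_evalAt_gridLim, ← Measure.compProd_eq_comp_prod,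
    Measure.compProd_const,
    ← hSX.map_prod_eq_prod_map_map hS.aemeasurable hX.measurable_path.aemeasurable,
    Measure.map_map measurable_pair_evalAt_gridLim (hS.prodMk hX.measurable_path)]
  rfl

end EvalKernel

section EvalKernelCharFun

variable {n : ℕ} {Ω : Type*} [MeasurableSpace Ω] {P : Measure Ω} [IsProbabilityMeasure P]
  {X : ℝ≥0 → Ω → EuclideanSpace ℝ (Fin n)} {μ : EuclideanSpace ℝ (Fin n)}
  {C : Matrix (Fin n) (Fin n) ℝ} {ν : Measure (EuclideanSpace ℝ (Fin n))}
  {s : EuclideanSpace ℝ (Fin n)}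

lemma charFun_evalKernel (hX : HasTriplet X P μ C ν) (hs : s ∈ monotoneCone n)
    (θ₁ θ₂ : EuclideanSpace ℝ (Fin n)) :
    charFun (evalKernel X P s) (pair θ₁ θ₂)
      = Complex.exp ((imInner θ₁ + diamondExponent μ C ν θ₂) s) := by
  rw [evalKernel_apply hX.isLevyProcess,
    charFun_map_pair (measurable_evalAt hX.isLevyProcess.measurable s), charFun_map_evalAt hX hs,
    ← Complex.exp_add, add_apply]

end EvalKernelCharFun

section Truncation

variable {E : Type*} [NormedAddCommGroup E]

/-- The truncation `x ↦ x 1_𝔻(x)` to the closed unit ball. -/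
def truncate (x : E) : E := (Metric.closedBall 0 1).indicator (fun y => y) x

lemma truncate_of_norm_le_one {x : E} (hx : ‖x‖ ≤ 1) : truncate x = x :=
  Set.indicator_of_mem (mem_closedBall_zero_iff.2 hx) _

lemma truncate_of_one_lt_norm {x : E} (hx : 1 < ‖x‖) : truncate x = 0 :=
  Set.indicator_of_notMem (fun h => hx.not_ge (mem_closedBall_zero_iff.1 h)) _

lemma norm_truncate_le_one (x : E) : ‖truncate x‖ ≤ 1 := by
  rcases le_or_gt ‖x‖ 1 with hx | hx
  · rwa [truncate_of_norm_le_one hx]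
  · simp [truncate_of_one_lt_norm hx]

@[fun_prop]
lemma measurable_truncate [MeasurableSpace E] [OpensMeasurableSpace E] :
    Measurable (truncate : E → E) :=
  measurable_id'.indicator measurableSet_closedBall

lemma integrable_truncate [MeasurableSpace E] [OpensMeasurableSpace E] [SecondCountableTopology E]
    (ρ : Measure E) [IsFiniteMeasure ρ] : Integrable truncate ρ :=
  (integrable_const 1).mono' measurable_truncate.aestronglyMeasurable
    (ae_of_all _ norm_truncate_le_one)

end Truncation

section LevyIntegrand

variable {E : Type*} [NormedAddCommGroup E] [InnerProductSpace ℝ E]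

/-- The integrand `exp(i⟨θ, x⟩) - 1 - i⟨θ, x⟩ 1_𝔻(x)` of the Lévy exponent. -/
def levyIntegrand (θ x : E) : ℂ := Complex.exp (imInner θ x) - 1 - imInner θ (truncate x)

lemma levyIntegrand_zero (θ : E) : levyIntegrand θ 0 = 0 := by
  simp [levyIntegrand, truncate_of_norm_le_one]

lemma norm_levyIntegrand_le (θ x : E) :
    ‖levyIntegrand θ x‖ ≤ (3 * ‖θ‖ ^ 2 + 2) * min (‖x‖ ^ 2) 1 := by
  have h_two : ‖Complex.exp (imInner θ x) - 1‖ ≤ 2 := norm_exp_sub_one_le_two (imInner_re θ x).le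
  rcases le_or_gt ‖x‖ 1 with hx | hx
  · rw [levyIntegrand, truncate_of_norm_le_one hx, min_eq_left (pow_le_one₀ (norm_nonneg x) hx)]
    have h_sq : ‖imInner θ x‖ ^ 2 ≤ ‖θ‖ ^ 2 * ‖x‖ ^ 2 := by
      rw [← mul_pow, imInner_apply]
      gcongr
      simpa using norm_inner_le_norm (𝕜 := ℝ) θ x
    suffices ‖Complex.exp (imInner θ x) - 1 - imInner θ x‖ ≤ 3 * ‖imInner θ x‖ ^ 2 by
      nlinarith [sq_nonneg ‖x‖]
    rcases le_total ‖imInner θ x‖ 1 with h | h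
    · linarith [Complex.norm_exp_sub_one_sub_id_le h, sq_nonneg ‖imInner θ x‖]
    · nlinarith [norm_sub_le (Complex.exp (imInner θ x) - 1) (imInner θ x)]
  · rw [levyIntegrand, truncate_of_one_lt_norm hx, map_zero, sub_zero,
      min_eq_right (one_le_pow₀ hx.le)]
    linarith [sq_nonneg ‖θ‖]

variable [MeasurableSpace E] {ν : Measure E}

lemma integral_levyIntegrand [CompleteSpace E] {θ : E}
    (hexp : Integrable (fun x => Complex.exp (imInner θ x) - 1) ν) (hid : Integrable truncate ν) :
    ∫ x, levyIntegrand θ x ∂ν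
      = ∫ x, (Complex.exp (imInner θ x) - 1) ∂ν - imInner θ (∫ x, truncate x ∂ν) := by
  rw [← ContinuousLinearMap.integral_comp_comm _ hid,
    ← integral_sub hexp ((imInner θ).integrable_comp hid)]
  rfl

variable [BorelSpace E]

@[fun_prop]
lemma measurable_levyIntegrand (θ : E) : Measurable (levyIntegrand θ) := by
  unfold levyIntegrand
  fun_prop

lemma integrable_levyIntegrand (hν : Integrable (fun x => min (‖x‖ ^ 2) 1) ν) (θ : E) :
    Integrable (levyIntegrand θ) ν :=
  (hν.const_mul _).mono' (by fun_prop) (ae_of_all _ (norm_levyIntegrand_le θ))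

end LevyIntegrand

section LevyExponent

variable {ι : Type*} [Fintype ι] {ν : Measure (EuclideanSpace ℝ ι)}

lemma levyExponent_eq_integral_levyIntegrand (γ : EuclideanSpace ℝ ι) (C : Matrix ι ι ℝ)
    (ν : Measure (EuclideanSpace ℝ ι)) (θ : EuclideanSpace ℝ ι) :
    levyExponent γ C ν θ
      = imInner θ γ - (1 / 2) * ((∑ k, ∑ l, θ k * C k l * θ l : ℝ) : ℂ)
        + ∫ x, levyIntegrand θ x ∂ν := by
  have h_trunc (x : EuclideanSpace ℝ ι) :
      (Metric.closedBall 0 1).indicator (fun y => inner ℝ θ y) x = inner ℝ θ (truncate x) :=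
    (congrFun (Set.indicator_comp_of_zero (g := fun y => inner ℝ θ y) (inner_zero_right θ)) x)
  simp only [levyExponent, levyIntegrand, imInner_apply, h_trunc, real_inner_comm θ γ]

lemma IsLevyMeasure.integrable_min (hν : IsLevyMeasure ν) :
    Integrable (fun x => min (‖x‖ ^ 2) 1) ν := by
  refine ⟨by fun_prop, ?_⟩
  rw [hasFiniteIntegral_iff_ofReal (ae_of_all _ fun x => by positivity)]
  exact hν.lintegral_lt_top

lemma integral_levyIntegrand_projMeasure (ν : Measure (EuclideanSpace ℝ ι)) (J : Set ι)
    (θ : EuclideanSpace ℝ ι) :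
    ∫ x, levyIntegrand θ x ∂projMeasure J ν = ∫ x, levyIntegrand θ (proj J x) ∂ν := by
  rw [projMeasure, setIntegral_eq_integral_of_forall_compl_eq_zero fun x hx => ?_,
    integral_map (by fun_prop) (by fun_prop)]
  rw [Set.notMem_compl_iff.1 hx, levyIntegrand_zero]

lemma integrable_levyIntegrand_proj (hν : Integrable (fun x => min (‖x‖ ^ 2) 1) ν) (J : Set ι)
    (θ : EuclideanSpace ℝ ι) : Integrable (fun x => levyIntegrand θ (proj J x)) ν := by
  have hm : Measurable fun x => levyIntegrand θ (proj J x) := by fun_prop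
  refine (hν.const_mul (3 * ‖θ‖ ^ 2 + 2)).mono' hm.aestronglyMeasurable
    (ae_of_all _ fun x => (norm_levyIntegrand_le θ _).trans ?_)
  gcongr
  exact norm_proj_le J x

lemma integrable_levyIntegrand_projMeasure (hν : Integrable (fun x => min (‖x‖ ^ 2) 1) ν)
    (J : Set ι) (θ : EuclideanSpace ℝ ι) : Integrable (levyIntegrand θ) (projMeasure J ν) :=
  ((integrable_map_measure (by fun_prop) (by fun_prop)).2
    (integrable_levyIntegrand_proj hν J θ)).mono_measure Measure.restrict_le_self

lemma integrableOn_truncate_proj (hν : Integrable (fun x => min (‖x‖ ^ 2) 1) ν) (J : Set ι) :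
    IntegrableOn (fun x => truncate (proj J x)) (Metric.closedBall 0 1)ᶜ ν := by
  have hfin : ν (Metric.closedBall 0 1)ᶜ < ∞ := by
    refine (measure_mono fun x hx => ?_).trans_lt (hν.measure_ge_lt_top one_pos)
    have hx : 1 < ‖x‖ := not_le.1 fun h => hx (mem_closedBall_zero_iff.2 h)
    exact le_min (one_le_pow₀ hx.le) le_rfl
  have hm : Measurable fun x => truncate (proj J x) := by fun_prop
  exact Measure.integrableOn_of_bounded hfin.ne hm.aestronglyMeasurable (M := 1)
    (ae_of_all _ fun x => norm_truncate_le_one _)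

lemma levyIntegrand_proj (J : Set ι) (θ x : EuclideanSpace ℝ ι) :
    levyIntegrand (proj J θ) x = levyIntegrand θ (proj J x)
      + imInner θ ((Metric.closedBall 0 1)ᶜ.indicator (fun x => truncate (proj J x)) x) := by
  have h_proj (y : EuclideanSpace ℝ ι) : imInner (proj J θ) y = imInner θ (proj J y) := by
    rw [imInner_apply, imInner_apply, inner_proj]
  rcases le_or_gt ‖x‖ 1 with hx | hx
  · have hpx : ‖proj J x‖ ≤ 1 := (norm_proj_le J x).trans hx
    simp [levyIntegrand, h_proj, truncate_of_norm_le_one, hx, hpx]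
  · simp [levyIntegrand, truncate_of_one_lt_norm hx, hx, h_proj x]

lemma integral_levyIntegrand_proj (hν : Integrable (fun x => min (‖x‖ ^ 2) 1) ν) (J : Set ι)
    (θ : EuclideanSpace ℝ ι) :
    ∫ x, levyIntegrand (proj J θ) x ∂ν = ∫ x, levyIntegrand θ x ∂projMeasure J ν
      + imInner θ (∫ x in (Metric.closedBall 0 1)ᶜ, truncate (proj J x) ∂ν) := by
  have hint := (integrable_indicator_iff measurableSet_closedBall.compl).2
    (integrableOn_truncate_proj hν J)
  rw [integral_levyIntegrand_projMeasure, ← integral_indicator measurableSet_closedBall.compl,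
    ← ContinuousLinearMap.integral_comp_comm _ hint,
    ← integral_add (integrable_levyIntegrand_proj hν J θ) ((imInner θ).integrable_comp hint)]
  simp only [levyIntegrand_proj]

end LevyExponent

section FiniteVariation

variable {ι : Type*} [Fintype ι] {Ω : Type*} [MeasurableSpace Ω] {P : Measure Ω}
  {T : ℝ≥0 → Ω → EuclideanSpace ℝ ι} {d : EuclideanSpace ℝ ι} {τ : Measure (EuclideanSpace ℝ ι)}

lemma indicator_closedBall_diff_zero_eq_truncate {E : Type*} [NormedAddCommGroup E] :
    (Metric.closedBall (0 : E) 1 \ {0}).indicator (fun x => x) = truncate := by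
  funext x
  rcases eq_or_ne x 0 with rfl | hx
  · simp [truncate_of_norm_le_one]
  · by_cases h : x ∈ Metric.closedBall (0 : E) 1 <;> simp_all [truncate, Set.indicator]

lemma IsFiniteVariation.exists_hasTriplet (hT : IsFiniteVariation T P d τ) :
    ∃ γ, HasTriplet T P γ 0 τ ∧ Integrable truncate τ ∧ d = γ - ∫ x, truncate x ∂τ := by
  obtain ⟨γ, hγ, hint, hd⟩ := hT
  have hm : MeasurableSet (Metric.closedBall (0 : EuclideanSpace ℝ ι) 1 \ {0}) :=
    measurableSet_closedBall.diff (measurableSet_singleton 0)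
  rw [← integrable_indicator_iff hm, indicator_closedBall_diff_zero_eq_truncate] at hint
  rw [← integral_indicator hm, indicator_closedBall_diff_zero_eq_truncate] at hd
  exact ⟨γ, hγ, hint, hd⟩

lemma IsFiniteVariation.isLevyProcess (hT : IsFiniteVariation T P d τ) : IsLevyProcess T P :=
  let ⟨_, hγ, _⟩ := hT
  hγ.isLevyProcess

lemma IsFiniteVariation.isLevyMeasure (hT : IsFiniteVariation T P d τ) : IsLevyMeasure τ :=
  let ⟨_, hγ, _⟩ := hT
  hγ.isLevyMeasure

lemma IsFiniteVariation.integrable_min_norm (hT : IsFiniteVariation T P d τ) :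
    Integrable (fun x => min 1 ‖x‖) τ := by
  obtain ⟨γ, hγ, hint, -⟩ := hT.exists_hasTriplet
  refine (hint.norm.add hγ.isLevyMeasure.integrable_min).mono' (by fun_prop)
    (ae_of_all _ fun x => ?_)
  rw [Real.norm_of_nonneg (by positivity), Pi.add_apply]
  rcases le_or_gt ‖x‖ 1 with hx | hx
  · rw [truncate_of_norm_le_one hx, min_eq_right hx]
    exact le_add_of_nonneg_right (by positivity)
  · rw [truncate_of_one_lt_norm hx, norm_zero, zero_add, min_eq_right (one_le_pow₀ hx.le)]
    exact min_le_left _ _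

lemma IsFiniteVariation.charFun_eq (hT : IsFiniteVariation T P d τ) (t : ℝ≥0)
    (θ : EuclideanSpace ℝ ι) :
    charFun (P.map (T t)) θ = Complex.exp (t * cumulant d τ (imInner θ)) := by
  have hexp := integrable_exp_sub_one hT.integrable_min_norm
    (ae_of_all _ fun x => (imInner_re θ x).le)
  obtain ⟨γ, hγ, hint, rfl⟩ := hT.exists_hasTriplet
  rw [hγ.charFun_eq, levyExponent_eq_integral_levyIntegrand, integral_levyIntegrand hexp hint,
    cumulant, map_sub]
  simp only [Matrix.zero_apply, mul_zero, zero_mul, Finset.sum_const_zero, Complex.ofReal_zero,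
    sub_zero]
  ring_nf

end FiniteVariation

section MonotoneComponents

variable {n : ℕ} {Ω : Type*} [MeasurableSpace Ω] {P : Measure Ω}
  {T : ℝ≥0 → Ω → EuclideanSpace ℝ (Fin n)} {d : EuclideanSpace ℝ (Fin n)}
  {τ : Measure (EuclideanSpace ℝ (Fin n))}

lemma IsSubordinator.ae_mem_monotoneCone (hT : IsSubordinator T P d τ)
    (hmono : ∀ᵐ ω ∂P, ∀ t, Monotone fun k => T t ω k) (t : ℝ≥0) :
    ∀ᵐ ω ∂P, T t ω ∈ monotoneCone n := by
  filter_upwards [hT.monotone, hmono, hT.isFiniteVariation.isLevyProcess.zero] with ω hinc hcomp h0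
  exact ⟨fun k => by simpa [h0] using hinc k (zero_le (a := t)), hcomp t⟩

lemma IsFiniteVariation.ae_map_mem_monotoneCone (hT : IsFiniteVariation T P d τ)
    (hTK : ∀ t, ∀ᵐ ω ∂P, T t ω ∈ monotoneCone n) (t : ℝ≥0) :
    ∀ᵐ s ∂P.map (T t), s ∈ monotoneCone n :=
  (ae_map_iff (hT.isLevyProcess.measurable t).aemeasurable
    isClosed_monotoneCone.measurableSet).2 (hTK t)

variable [IsProbabilityMeasure P]

lemma IsFiniteVariation.drift_mem_monotoneCone (hT : IsFiniteVariation T P d τ)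
    (hTK : ∀ t, ∀ᵐ ω ∂P, T t ω ∈ monotoneCone n) :
    d ∈ monotoneCone n :=
  have (t : ℝ≥0) : IsProbabilityMeasure (P.map (T t)) :=
    Measure.isProbabilityMeasure_map (hT.isLevyProcess.measurable t).aemeasurable
  drift_mem_of_forall_ae_mem hT.integrable_min_norm hT.charFun_eq isClosed_monotoneCone
    smul_mem_monotoneCone (hT.ae_map_mem_monotoneCone hTK)

lemma IsFiniteVariation.levyMeasure_ae_mem_monotoneCone (hT : IsFiniteVariation T P d τ)
    (hTK : ∀ t, ∀ᵐ ω ∂P, T t ω ∈ monotoneCone n) :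
    ∀ᵐ s ∂τ, s ∈ monotoneCone n :=
  have (t : ℝ≥0) : IsProbabilityMeasure (P.map (T t)) :=
    Measure.isProbabilityMeasure_map (hT.isLevyProcess.measurable t).aemeasurable
  levyMeasure_ae_mem_of_forall_ae_mem hT.integrable_min_norm hT.charFun_eq isClosed_monotoneCone
    zero_mem_monotoneCone (hT.ae_map_mem_monotoneCone hTK)

lemma IsFiniteVariation.restrict_puncturedOrthant (hT : IsFiniteVariation T P d τ)
    (hTK : ∀ t, ∀ᵐ ω ∂P, T t ω ∈ monotoneCone n) :
    τ.restrict (puncturedOrthant (Fin n)) = τ := by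
  refine Measure.restrict_eq_self_of_ae_mem ?_
  filter_upwards [hT.levyMeasure_ae_mem_monotoneCone hTK,
    measure_eq_zero_iff_ae_notMem.1 hT.isLevyMeasure.zero] with s hs h0
  exact ⟨hs.1, h0⟩

end MonotoneComponents

section SubordinatedLaw

lemma charFun_comp {α E : Type*} [MeasurableSpace α] [NormedAddCommGroup E]
    [InnerProductSpace ℝ E] [MeasurableSpace E] [BorelSpace E] (κ : Kernel α E) [IsMarkovKernel κ]
    (ρ : Measure α) [IsFiniteMeasure ρ] (θ : E) :
    charFun (κ ∘ₘ ρ) θ = ∫ a, charFun (κ a) θ ∂ρ := by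
  have hint := integrable_exp_imInner (κ ∘ₘ ρ) θ
  simp only [charFun_eq_integral_imInner]
  rw [Measure.comp_eq_comp_const_apply] at hint ⊢
  exact Kernel.integral_comp hint

variable {n : ℕ} {Ω : Type*} [MeasurableSpace Ω] {P : Measure Ω} [IsProbabilityMeasure P]
  {X T : ℝ≥0 → Ω → EuclideanSpace ℝ (Fin n)} {μ : EuclideanSpace ℝ (Fin n)}
  {C : Matrix (Fin n) (Fin n) ℝ} {ν : Measure (EuclideanSpace ℝ (Fin n))}
  {d : EuclideanSpace ℝ (Fin n)} {τ : Measure (EuclideanSpace ℝ (Fin n))}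
  {s : EuclideanSpace ℝ (Fin n)}

lemma imInner_add_diamondExponent_re_nonpos (hX : HasTriplet X P μ C ν) (hs : s ∈ monotoneCone n)
    (θ₁ θ₂ : EuclideanSpace ℝ (Fin n)) :
    ((imInner θ₁ + diamondExponent μ C ν θ₂) s).re ≤ 0 := by
  rw [add_apply, Complex.add_re, imInner_re, zero_add]
  exact diamondExponent_re_nonpos hX hs θ₂

theorem charFun_map_pair_evalAt (hX : HasTriplet X P μ C ν) (hT : IsFiniteVariation T P d τ)
    (hTK : ∀ t, ∀ᵐ ω ∂P, T t ω ∈ monotoneCone n) {t : ℝ≥0}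
    (hTX : IndepFun (T t) (fun ω t => X t ω) P) (θ₁ θ₂ : EuclideanSpace ℝ (Fin n)) :
    charFun (P.map fun ω => pair (T t ω) (evalAt X (T t ω) ω)) (pair θ₁ θ₂)
      = Complex.exp (t * cumulant d τ (imInner θ₁ + diamondExponent μ C ν θ₂)) := by
  have hTm := hT.isLevyProcess.measurable t
  have := isMarkovKernel_evalKernel hX.isLevyProcess
  have := Measure.isProbabilityMeasure_map (μ := P) hTm.aemeasurable
  have hre (s) (hs : s ∈ monotoneCone n) := imInner_add_diamondExponent_re_nonpos hX hs θ₁ θ₂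
  have hmapK := hT.ae_map_mem_monotoneCone hTK t
  calc _ = ∫ s, charFun (evalKernel X P s) (pair θ₁ θ₂) ∂P.map (T t) := by
        rw [map_pair_evalAt hX.isLevyProcess hTm hTX, charFun_comp]
    _ = ∫ s, Complex.exp ((imInner θ₁ + diamondExponent μ C ν θ₂) s) ∂P.map (T t) :=
        integral_congr_ae (hmapK.mono fun s hs => charFun_evalKernel hX hs θ₁ θ₂)
    _ = _ := integral_exp_eq_exp_cumulant hT.integrable_min_norm t.coe_nonneg (hT.charFun_eq t)
        (hmapK.mono hre) ((hT.levyMeasure_ae_mem_monotoneCone hTK).mono hre)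
        (hre d (hT.drift_mem_monotoneCone hTK))

end SubordinatedLaw

section Drift

variable {n : ℕ} {d : EuclideanSpace ℝ (Fin n)} {ν : Measure (EuclideanSpace ℝ (Fin n))}

lemma sort_eq_self (hd : d ∈ monotoneCone n) (k : Fin n) : Tuple.sort d k = k := by
  rw [Tuple.sort_eq_refl_iff_monotone.2 hd.2, Equiv.refl_apply]

lemma spacing_eq_increment (hd : d ∈ monotoneCone n) (k : Fin n) :
    spacing d k = increment k d := by
  obtain _ | n := n
  · exact k.elim0
  rw [increment_eq_cons_sub, spacing, sort_eq_self hd]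
  cases k using Fin.cases with
  | zero => simp
  | succ k =>
    rw [if_neg (by simp), sort_eq_self hd, Fin.cons_succ, ← Fin.succ_castSucc, Fin.cons_succ]
    rfl

lemma upperSet_eq_Ici (hd : d ∈ monotoneCone n) (k : Fin n) : upperSet d k = Set.Ici k := by
  ext j
  simp [upperSet, sort_eq_self hd]

lemma imInner_diamondVec (d μ θ : EuclideanSpace ℝ (Fin n)) :
    imInner θ (diamondVec d μ) = ∑ j, (increment j d : ℂ) * imInner (proj (Set.Ici j) θ) μ := by
  have h_coord (k : Fin n) : diamondVec d μ k * θ k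
      = ∑ j, increment j d * (μ k * proj (Set.Ici j) θ k) := by
    simp only [diamondVec, ← sum_increment d k, proj_apply, Set.mem_Ici, mul_ite, mul_zero,
      ← Finset.sum_filter, Finset.filter_ge_eq_Iic, Finset.sum_mul, mul_assoc]
  have h_inner : inner ℝ θ (diamondVec d μ)
      = ∑ j, increment j d * inner ℝ (proj (Set.Ici j) θ) μ := by
    simp only [PiLp.inner_apply, RCLike.inner_apply, conj_trivial, h_coord, Finset.mul_sum]
    exact Finset.sum_comm
  simp only [imInner_apply, h_inner, Complex.ofReal_sum, Complex.ofReal_mul, Finset.mul_sum,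
    mul_left_comm]

lemma sum_diamondMat (hd : d ∈ monotoneCone n) (C : Matrix (Fin n) (Fin n) ℝ)
    (θ : EuclideanSpace ℝ (Fin n)) :
    ∑ k, ∑ l, θ k * diamondMat d C k l * θ l
      = ∑ j, increment j d *
        ∑ k, ∑ l, proj (Set.Ici j) θ k * C k l * proj (Set.Ici j) θ l := by
  have h_entry (k l : Fin n) : θ k * diamondMat d C k l * θ l
      = ∑ j, increment j d * (proj (Set.Ici j) θ k * C k l * proj (Set.Ici j) θ l) := by
    have h_min : min (d k) (d l) = ∑ j, if j ≤ k ∧ j ≤ l then increment j d else 0 := by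
      rw [← hd.2.map_min, ← sum_increment, ← Finset.sum_filter]
      simp only [← le_min_iff, Finset.filter_ge_eq_Iic]
    rw [diamondMat, Matrix.of_apply, h_min, Finset.mul_sum, Finset.mul_sum, Finset.sum_mul]
    refine Finset.sum_congr rfl fun j _ => ?_
    by_cases hk : j ≤ k <;> by_cases hl : j ≤ l <;> simp [proj_apply, hk, hl]
    ring
  simp_rw [h_entry, Finset.mul_sum]
  exact Finset.sum_comm_cycle

-- The first summand, absent from the definition of `compensation`, vanishes: its projection is
-- the identity.
lemma compensation_eq_sum (hd : d ∈ monotoneCone n) (ν : Measure (EuclideanSpace ℝ (Fin n))) :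
    compensation d ν = ∑ j, increment j d •
      ∫ x in (Metric.closedBall 0 1)ᶜ, truncate (proj (Set.Ici j) x) ∂ν := by
  rw [compensation, Finset.sum_filter]
  refine Finset.sum_congr rfl fun j _ => ?_
  rw [spacing_eq_increment hd, upperSet_eq_Ici hd]
  split_ifs with hj
  · rfl
  · have h_univ : Set.Ici j = Set.univ :=
      Set.eq_univ_of_forall fun k => Fin.mk_le_of_le_val (by omega)
    rw [setIntegral_eq_zero_of_forall_eq_zero, smul_zero]
    intro x hx
    rw [h_univ, proj_univ, truncate, Set.indicator_of_notMem hx]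

lemma integral_levyIntegrand_diamondMeasure (hd : d ∈ monotoneCone n) (hν : IsLevyMeasure ν)
    (θ : EuclideanSpace ℝ (Fin n)) :
    ∫ x, levyIntegrand θ x ∂diamondMeasure d ν
      = ∑ j, (increment j d : ℂ) * ∫ x, levyIntegrand θ x ∂projMeasure (Set.Ici j) ν := by
  rw [diamondMeasure, integral_finsetSum_measure fun j _ =>
    (integrable_levyIntegrand_projMeasure hν.integrable_min _ θ).smul_measure ENNReal.ofReal_ne_top]
  refine Finset.sum_congr rfl fun j _ => ?_
  rw [integral_smul_measure, spacing_eq_increment hd, upperSet_eq_Ici hd,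
    ENNReal.toReal_ofReal (increment_nonneg hd j), Complex.real_smul]

theorem levyExponent_diamond (hd : d ∈ monotoneCone n) (hν : IsLevyMeasure ν)
    (μ : EuclideanSpace ℝ (Fin n)) (C : Matrix (Fin n) (Fin n) ℝ) (θ : EuclideanSpace ℝ (Fin n)) :
    levyExponent (compensation d ν + diamondVec d μ) (diamondMat d C) (diamondMeasure d ν) θ
      = diamondExponent μ C ν θ d := by
  simp only [diamondExponent_apply, levyExponent_eq_integral_levyIntegrand, map_add,
    imInner_diamondVec, sum_diamondMat hd, compensation_eq_sum hd, map_sum, map_smul,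
    Complex.real_smul, integral_levyIntegrand_diamondMeasure hd hν,
    integral_levyIntegrand_proj hν.integrable_min, Complex.ofReal_sum, Complex.ofReal_mul,
    mul_add, mul_sub, Finset.sum_add_distrib, Finset.sum_sub_distrib, Finset.mul_sum,
    mul_left_comm (1 / 2 : ℂ)]
  ring

end Drift

section WeakIntegrals

variable {ι : Type*} [Fintype ι]

lemma levyIntegrand_pair_zero (θ₁ θ₂ x : EuclideanSpace ℝ ι) :
    levyIntegrand (pair θ₁ θ₂) (pair 0 x) = levyIntegrand θ₂ x := by
  rcases le_or_gt ‖x‖ 1 with hx | hx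
  · have hx' : ‖pair 0 x‖ ≤ 1 := (norm_pair_zero x).trans_le hx
    simp [levyIntegrand, truncate_of_norm_le_one, hx, hx', imInner_pair]
  · have hx' : 1 < ‖pair 0 x‖ := hx.trans_eq (norm_pair_zero x).symm
    simp [levyIntegrand, truncate_of_one_lt_norm, hx, hx', imInner_pair]

lemma integral_levyIntegrand_map_pair_zero (ρ : Measure (EuclideanSpace ℝ ι))
    (θ₁ θ₂ : EuclideanSpace ℝ ι) :
    ∫ z, levyIntegrand (pair θ₁ θ₂) z ∂ρ.map (fun x => pair 0 x)
      = ∫ x, levyIntegrand θ₂ x ∂ρ := by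
  rw [integral_map (measurable_pair measurable_const measurable_id').aemeasurable (by fun_prop)]
  simp only [levyIntegrand_pair_zero]

lemma integral_truncate_evalKernel {Ω : Type*} [MeasurableSpace Ω] {P : Measure Ω}
    [IsProbabilityMeasure P] {X : ℝ≥0 → Ω → EuclideanSpace ℝ ι} (hX : IsLevyProcess X P)
    (s : EuclideanSpace ℝ ι) :
    ∫ z, truncate z ∂evalKernel X P s
      = pair (P.real {ω | pair s (evalAt X s ω) ∈ Metric.closedBall 0 1} • s)
          (∫ ω in {ω | pair s (evalAt X s ω) ∈ Metric.closedBall 0 1}, evalAt X s ω ∂P) := by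
  have hpair : Measurable fun ω => pair s (evalAt X s ω) :=
    measurable_pair measurable_const (measurable_evalAt hX.measurable s)
  have hball : MeasurableSet {ω | pair s (evalAt X s ω) ∈ Metric.closedBall 0 1} :=
    hpair measurableSet_closedBall
  have htrunc : (fun ω => truncate (pair s (evalAt X s ω)))
      = {ω | pair s (evalAt X s ω) ∈ Metric.closedBall 0 1}.indicator
          fun ω => pair s (evalAt X s ω) := rfl
  have hint := (integrable_truncate (P.map fun ω => pair s (evalAt X s ω))).comp_measurable hpair
  rw [Function.comp_def, htrunc, integrable_indicator_iff hball] at hint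
  rw [evalKernel_apply hX, integral_map hpair.aemeasurable (by fun_prop), htrunc,
    integral_indicator hball, integral_pair hint, setIntegral_const]

lemma integral_levyIntegrand_eq_charFun (ρ : Measure (EuclideanSpace ℝ ι))
    [IsProbabilityMeasure ρ] (θ : EuclideanSpace ℝ ι) :
    ∫ x, levyIntegrand θ x ∂ρ = charFun ρ θ - 1 - imInner θ (∫ x, truncate x ∂ρ) := by
  rw [integral_levyIntegrand ((integrable_exp_imInner ρ θ).sub (integrable_const 1))
    (integrable_truncate ρ), integral_exp_imInner_sub_one]

lemma integrable_of_forall_inner {α : Type*} [MeasurableSpace α] {ρ : Measure α}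
    {V : α → EuclideanSpace ℝ ι} (h : ∀ θ, Integrable (fun a => inner ℝ θ (V a)) ρ) :
    Integrable V ρ := by
  classical
  refine Integrable.of_eval_piLp fun i => ?_
  simpa [EuclideanSpace.inner_single_left] using h (EuclideanSpace.single i 1)

variable {α : Type*} [MeasurableSpace α] {κ : Kernel α (EuclideanSpace ℝ ι)} [IsMarkovKernel κ]
  {m : Measure α}

-- The truncated means are integrable because they are, up to sign, the imaginary part of the
-- difference of two integrable functions, `∫ levyIntegrand θ ∂κ s` and `charFun (κ s) θ - 1`.
lemma integrable_integral_truncate (hκ : Integrable (fun x => min (‖x‖ ^ 2) 1) (κ ∘ₘ m))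
    (hchar : ∀ θ, Integrable (fun s => charFun (κ s) θ - 1) m) :
    Integrable (fun s => ∫ x, truncate x ∂κ s) m := by
  refine integrable_of_forall_inner fun θ => ?_
  have hint := integrable_levyIntegrand hκ θ
  rw [Measure.comp_eq_comp_const_apply] at hint
  have hint : Integrable (fun s => ∫ x, levyIntegrand θ x ∂κ s) m := by
    simpa using hint.integral_comp
  refine ((hchar θ).sub hint).im.congr (ae_of_all _ fun s => ?_)
  simp [integral_levyIntegrand_eq_charFun, imInner_apply]

lemma integral_levyIntegrand_comp (hκ : Integrable (fun x => min (‖x‖ ^ 2) 1) (κ ∘ₘ m))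
    (hchar : ∀ θ, Integrable (fun s => charFun (κ s) θ - 1) m) (θ : EuclideanSpace ℝ ι) :
    ∫ x, levyIntegrand θ x ∂(κ ∘ₘ m)
      = ∫ s, (charFun (κ s) θ - 1) ∂m - imInner θ (∫ s, ∫ x, truncate x ∂κ s ∂m) := by
  have hint := integrable_levyIntegrand hκ θ
  have htrunc := integrable_integral_truncate hκ hchar
  rw [Measure.comp_eq_comp_const_apply] at hint ⊢
  rw [Kernel.integral_comp hint, Kernel.const_apply]
  simp only [integral_levyIntegrand_eq_charFun]
  rw [integral_sub (hchar θ) ((imInner θ).integrable_comp htrunc),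
    ContinuousLinearMap.integral_comp_comm _ htrunc]

end WeakIntegrals

section WeakExponent

variable {n : ℕ} {Ω : Type*} [MeasurableSpace Ω] {P : Measure Ω} [IsProbabilityMeasure P]
  {X T : ℝ≥0 → Ω → EuclideanSpace ℝ (Fin n)} {μ : EuclideanSpace ℝ (Fin n)}
  {C : Matrix (Fin n) (Fin n) ℝ} {ν : Measure (EuclideanSpace ℝ (Fin n))}
  {d : EuclideanSpace ℝ (Fin n)} {τ : Measure (EuclideanSpace ℝ (Fin n))}

lemma quadratic_form_weakCov (C : Matrix (Fin n) (Fin n) ℝ) (d θ₁ θ₂ : EuclideanSpace ℝ (Fin n)) :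
    ∑ k, ∑ l, pair θ₁ θ₂ k * weakCov C d k l * pair θ₁ θ₂ l
      = ∑ k, ∑ l, θ₂ k * diamondMat d C k l * θ₂ l := by
  simp [weakCov, pair, Fintype.sum_sum_type]

lemma integrable_charFun_evalKernel_sub_one (hX : HasTriplet X P μ C ν)
    (hT : IsFiniteVariation T P d τ) (hTK : ∀ t, ∀ᵐ ω ∂P, T t ω ∈ monotoneCone n)
    (θ : EuclideanSpace ℝ (Fin n ⊕ Fin n)) :
    Integrable (fun s => charFun (evalKernel X P s) θ - 1) τ := by
  obtain ⟨θ₁, θ₂, rfl⟩ := exists_eq_pair θ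
  have hτK := hT.levyMeasure_ae_mem_monotoneCone hTK
  refine (integrable_exp_sub_one hT.integrable_min_norm (hτK.mono fun s hs =>
    imInner_add_diamondExponent_re_nonpos hX hs θ₁ θ₂)).congr ?_
  filter_upwards [hτK] with s hs
  rw [charFun_evalKernel hX hs]

lemma weakLevyMeasure_eq (hX : IsLevyProcess X P) (hT : IsFiniteVariation T P d τ)
    (hTK : ∀ t, ∀ᵐ ω ∂P, T t ω ∈ monotoneCone n) :
    weakLevyMeasure X P ν d τ
      = (diamondMeasure d ν).map (fun x => pair 0 x) + evalKernel X P ∘ₘ τ := by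
  rw [weakLevyMeasure, hT.restrict_puncturedOrthant hTK]
  simp only [← evalKernel_apply hX]

lemma pair_weakLoc_eq (hX : IsLevyProcess X P) (hT : IsFiniteVariation T P d τ)
    (hTK : ∀ t, ∀ᵐ ω ∂P, T t ω ∈ monotoneCone n)
    (hint : Integrable (fun s => ∫ z, truncate z ∂evalKernel X P s) τ) :
    pair (weakLoc₁ X P d τ) (weakLoc₂ X P μ ν d τ)
      = pair d (compensation d ν + diamondVec d μ)
        + ∫ s, ∫ z, truncate z ∂evalKernel X P s ∂τ := by
  simp only [integral_truncate_evalKernel hX] at hint ⊢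
  rw [weakLoc₁, weakLoc₂, hT.restrict_puncturedOrthant hTK, integral_pair hint, pair_add_pair]

theorem levyExponent_weakSubordination (hX : HasTriplet X P μ C ν)
    (hT : IsFiniteVariation T P d τ) (hTK : ∀ t, ∀ᵐ ω ∂P, T t ω ∈ monotoneCone n)
    (hZ : IsLevyMeasure (weakLevyMeasure X P ν d τ)) (θ₁ θ₂ : EuclideanSpace ℝ (Fin n)) :
    levyExponent (pair (weakLoc₁ X P d τ) (weakLoc₂ X P μ ν d τ)) (weakCov C d)
        (weakLevyMeasure X P ν d τ) (pair θ₁ θ₂)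
      = cumulant d τ (imInner θ₁ + diamondExponent μ C ν θ₂) := by
  have hXL := hX.isLevyProcess
  have := isMarkovKernel_evalKernel hXL
  have hd := hT.drift_mem_monotoneCone hTK
  have hchar := integrable_charFun_evalKernel_sub_one hX hT hTK
  have hmin := hZ.integrable_min
  rw [weakLevyMeasure_eq hXL hT hTK, integrable_add_measure] at hmin
  obtain ⟨hmin_drift, hmin_jump⟩ := hmin
  have hjump : ∫ s, (charFun (evalKernel X P s) (pair θ₁ θ₂) - 1) ∂τ
      = ∫ s, (Complex.exp ((imInner θ₁ + diamondExponent μ C ν θ₂) s) - 1) ∂τ :=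
    integral_congr_ae ((hT.levyMeasure_ae_mem_monotoneCone hTK).mono fun s hs =>
      congrArg (· - 1) (charFun_evalKernel hX hs θ₁ θ₂))
  rw [levyExponent_eq_integral_levyIntegrand, weakLevyMeasure_eq hXL hT hTK,
    pair_weakLoc_eq hXL hT hTK (integrable_integral_truncate hmin_jump hchar),
    integral_add_measure (integrable_levyIntegrand hmin_drift _)
      (integrable_levyIntegrand hmin_jump _),
    integral_levyIntegrand_map_pair_zero, integral_levyIntegrand_comp hmin_jump hchar, hjump,
    quadratic_form_weakCov, cumulant, add_apply, ← levyExponent_diamond hd hX.isLevyMeasure,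
    levyExponent_eq_integral_levyIntegrand, map_add, imInner_pair]
  ring

end WeakExponent

end WeakSubordination

end

theorem proposition3p4 {n : ℕ} {Ω Ω' : Type*} [MeasurableSpace Ω] [MeasurableSpace Ω']
    (P : Measure Ω) [IsProbabilityMeasure P] (P' : Measure Ω') [IsProbabilityMeasure P']
    (X T : ℝ≥0 → Ω → EuclideanSpace ℝ (Fin n))
    (Z : ℝ≥0 → Ω' → EuclideanSpace ℝ (Fin n ⊕ Fin n))
    (μ : EuclideanSpace ℝ (Fin n)) (C : Matrix (Fin n) (Fin n) ℝ)
    (ν : Measure (EuclideanSpace ℝ (Fin n)))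
    (d : EuclideanSpace ℝ (Fin n)) (τ : Measure (EuclideanSpace ℝ (Fin n)))
    (hX : WeakSubordination.HasTriplet X P μ C ν)
    (hT : WeakSubordination.IsSubordinator T P d τ)
    (hTX : IndepFun (fun ω (t : ℝ≥0) => T t ω) (fun ω (t : ℝ≥0) => X t ω) P)
    (hZ : WeakSubordination.IsWeakSubordination Z P' X P μ C ν d τ)
    (hmono : ∀ᵐ ω ∂P, ∀ t, Monotone (fun k : Fin n => T t ω k))
    (t : ℝ≥0) :
    IdentDistrib (Z t)
      (fun ω => WeakSubordination.pair (T t ω) (WeakSubordination.evalAt X (T t ω) ω)) P' P := by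
  open WeakSubordination in
  have hTK := hT.ae_mem_monotoneCone hmono
  have hFV := hT.isFiniteVariation
  have hZm := (hZ.isLevyProcess.measurable t).aemeasurable (μ := P')
  have hpair := aemeasurable_pair_evalAt hX.isLevyProcess (hFV.isLevyProcess.measurable t)
  refine ⟨hZm, hpair, ?_⟩
  have := Measure.isProbabilityMeasure_map (μ := P') hZm
  have := Measure.isProbabilityMeasure_map (μ := P) hpair
  refine Measure.ext_of_charFun (funext fun θ => ?_)
  obtain ⟨θ₁, θ₂, rfl⟩ := exists_eq_pair θ
  rw [hZ.charFun_eq, levyExponent_weakSubordination hX hFV hTK hZ.isLevyMeasure,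
    charFun_map_pair_evalAt hX hFV hTK (hTX.comp (measurable_pi_apply t) measurable_id)]
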